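/- **Truncation estimate for the GKP dissipative dynamics.** Let $\mathcal H=\ell^2(\mathbb N)$ with Fock basis $(|n\rangle)_{n\ge 0}$, and let $a=\sum_{n\ge1}\sqrt n\,|n-1\rangle\langle n|$, $a^\dagger=\sum_{n\ge0}\sqrt{n+1}\,|n+1\rangle\langle n|$, $q=(a+a^\dagger)/\sqrt2$, $p=(a-a^\dagger)/(i\sqrt2)$. Let $\mathcal A,\eta,\varepsilon\in\mathbb R$ and put $$U=e^{i\eta q},\qquad Q=\mathcal A(\mathrm{Id}-\varepsilon p),\qquad R=e^{i\pi a^\dagger a/2},\qquad \Gamma_0=UQ-\mathrm{Id},\qquad \Gamma_k=R^k\Gamma_0R^{-k}\quad(0\le k\le 3).$$ For an operator $\Gamma$ put $\mathcal D_\Gamma(\rho)=\Gamma\rho\Gamma^\dagger-\tfrac12(\Gamma^\dagger\Gamma\rho+\rho\,\Gamma^\dagger\Gamma)$. Let $P_N=\sum_{i=0}^N|i\rangle\langle i|$, $P_N^\perp=\mathrm{Id}-P_N$, $\mathcal H_N=P_N\mathcal H$, $U_{N+1}=P_{N+1}UP_{N+1}$, and $$\mathcal L(\rho)=\sum_{k=0}^3\mathcal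 D_{\Gamma_k}(\rho),\qquad \mathcal L_N(\rho)=\sum_{k=0}^3\mathcal D_{P_N\Gamma_kP_N}(\rho).$$ Let $\|X\|_1=\mathrm{Tr}\sqrt{X^\dagger X}$ be the trace norm. Let $N\in\mathbb N$ and let $\rho_{(N)}$ be any positive semidefinite operator on $\mathcal H_N$, that is, $\rho_{(N)}\ge 0$ is a bounded operator on $\mathcal H$ with $\rho_{(N)}=P_N\rho_{(N)}P_N$. Then $(\mathcal L-\mathcal L_N)(\rho_{(N)})$, where $\mathcal L$ and $\mathcal L_N$ are formed with the natural domains of sums and products of unbounded operators, is densely defined and extends to a trace-class operator on $\mathcal H$, which satisfies $$\|(\mathcal L-\mathcal L_N)\rho_{(N)}\|_1\;\le\;\sum_{k=0}^{3}f\big(R^{-k}\rho_{(N)}R^{k}\big),$$ where, for $\rho=P_N\rho P_N$, $$\begin{aligned}f(\rho)={}&\mathrm{Tr}(Q\rho Q^\dagger)-\mathrm{Tr}(P_NUQ\rho Q^\dagger U^\dagger P_N)+2\,\|P_N^\perp UQ\rho Q^\dagger U^\dagger P_N\|_1\\&+\|(Q^\dagger Q-P_NQ^\dagger U_{N+1}^\dagger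 P_NU_{N+1}QP_N)\rho\|_1+\|P_N^\perp UQ\rho\|_1\\&+|\mathcal A|\,\big\|P_N^\perp U^\dagger\big((1+\varepsilon\eta)\mathrm{Id}-\varepsilon p\big)\rho\big\|_1 .\end{aligned}$$ Moreover $f$ is a finite-dimensional expression in which $U$ enters only through the truncated unitary $U_{N+1}$: with $M=Q\rho Q^\dagger U_{N+1}^\dagger P_N$ and $S=(1+\varepsilon\eta)\mathrm{Id}-\varepsilon p$, $$\begin{aligned}f(\rho)={}&\mathrm{Tr}(Q\rho Q^\dagger)-\mathrm{Tr}(P_NU_{N+1}Q\rho Q^\dagger U_{N+1}^\dagger P_N)+2\,\mathrm{Tr}\sqrt{M^\dagger(P_{N+1}-U_{N+1}^\dagger P_NU_{N+1})M}\\&+\|(Q^\dagger Q-P_NQ^\dagger U_{N+1}^\dagger P_NU_{N+1}QP_N)\rho\|_1+\mathrm{Tr}\sqrt{(Q\rho)^\dagger(P_{N+1}-U_{N+1}^\dagger P_NU_{N+1})(Q\rho)}\\&+|\mathcal A|\,\mathrm{Tr}\sqrt{(S\rho)^\dagger(P_{N+1}-U_{N+1}P_NU_{N+1}^\dagger)(S\rho)}.\end{aligned}$$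 -/

import Mathlib

open scoped ENNReal

noncomputable section

namespace GKP

/-- The Hilbert space `ℓ²(ℕ)` of one bosonic mode. -/
abbrev Fock : Type := lp (fun _ : ℕ => ℂ) 2

/-- The Fock state `|n⟩`. -/
def ket (n : ℕ) : Fock := lp.single 2 n (1 : ℂ)

/-! ### Ladder operators on finite superpositions of Fock states -/

/-- The dense subspace of finite linear combinations of Fock states. -/
def finiteFock : Submodule ℂ Fock where
  carrier := {u | {n | u n ≠ 0}.Finite}
  zero_mem' := by simp
  add_mem' {u v} hu hv := (hu.union hv).subset fun n hn => by
    by_contra h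
    simp only [Set.mem_union, Set.mem_ofPred_eq, not_or, not_not] at h
    exact hn (by simp [h.1, h.2])
  smul_mem' c u hu := hu.subset fun n hn h => hn (by simp [h])

/-- A finitely supported sequence, as an element of `finiteFock`. -/
def mkFinite (f : ℕ → ℂ) (hf : {n | f n ≠ 0}.Finite) : finiteFock :=
  ⟨⟨f, (memℓp_zero hf).of_exponent_ge (by simp)⟩, hf⟩

theorem mkFinite_apply (f : ℕ → ℂ) (hf : {n | f n ≠ 0}.Finite) (n : ℕ) :
    (mkFinite f hf : Fock) n = f n := rfl

theorem finiteFock_ext {u v : finiteFock} (h : ∀ n, (u : Fock) n = (v : Fock) n) : u = v :=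
  Subtype.ext (lp.ext (funext h))

theorem ket_mem (n : ℕ) : ket n ∈ finiteFock :=
  (Set.finite_singleton n).subset fun m hm => by
    by_contra h
    exact hm (by simp [ket, Pi.single_eq_of_ne h])

/-- The Fock state `|n⟩` as an element of `finiteFock`. -/
def ketF (n : ℕ) : finiteFock := ⟨ket n, ket_mem n⟩

/-- The annihilation operator `a = ∑ √n |n-1⟩⟨n|` on `finiteFock`. -/
def annihilation : Module.End ℂ finiteFock where
  toFun u := mkFinite (fun n => (Real.sqrt (n + 1) : ℂ) * (u : Fock) (n + 1))
    ((u.2.preimage (f := fun n => n + 1) (fun _ _ _ _ h => Nat.succ_injective h)).subset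
      fun _ hn => right_ne_zero_of_mul hn)
  map_add' u v := finiteFock_ext fun n => by simp [mkFinite_apply, mul_add]
  map_smul' c u := finiteFock_ext fun n => by simp [mkFinite_apply, mul_left_comm]

/-- The creation operator `a† = ∑ √(n+1) |n+1⟩⟨n|` on `finiteFock`. -/
def creation : Module.End ℂ finiteFock where
  toFun u := mkFinite (fun n => (Real.sqrt n : ℂ) * (u : Fock) (n - 1))
    ((u.2.image (fun n => n + 1)).subset fun n hn => by
      refine ⟨n - 1, right_ne_zero_of_mul hn, ?_⟩
      rcases n with _ | n
      · simp at hn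
      · simp)
  map_add' u v := finiteFock_ext fun n => by simp [mkFinite_apply, mul_add]
  map_smul' c u := finiteFock_ext fun n => by simp [mkFinite_apply, mul_left_comm]

/-- The position operator `q = (a + a†)/√2` on `finiteFock`. -/
def position : Module.End ℂ finiteFock :=
  (1 / (Real.sqrt 2 : ℂ)) • (annihilation + creation)

/-- The momentum operator `p = (a - a†)/(i√2)` on `finiteFock`. -/
def momentum : Module.End ℂ finiteFock :=
  (1 / (Complex.I * (Real.sqrt 2 : ℂ))) • (annihilation - creation)

/-! ### Facts needed to construct `e^{iηq}` -/

theorem norm_sq_eq (u : Fock) : ‖u‖ ^ 2 = ∑' n, ‖u n‖ ^ 2 := by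
  have := lp.norm_rpow_eq_tsum (p := 2) (by norm_num) u
  simpa using this

theorem summable_sq (u : Fock) : Summable fun n => ‖u n‖ ^ 2 := by
  have := (lp.hasSum_norm (p := 2) (by norm_num) u).summable
  simpa using this

theorem norm_annihilation_le (u : finiteFock) (N : ℕ) (hu : ∀ n, N ≤ n → (u : Fock) n = 0) :
    ‖annihilation u‖ ≤ Real.sqrt N * ‖u‖ := by
  have h : ‖(annihilation u : Fock)‖ ^ 2 ≤ N * ‖(u : Fock)‖ ^ 2 := by
    rw [norm_sq_eq, norm_sq_eq, ← tsum_mul_left,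
      ((summable_sq (u : Fock)).mul_left (N : ℝ)).tsum_eq_zero_add]
    refine le_add_of_nonneg_of_le (by positivity) ?_
    refine (summable_sq _).tsum_le_tsum (fun n => ?_)
      ((summable_nat_add_iff 1).2 ((summable_sq (u : Fock)).mul_left (N : ℝ)))
    change ‖(Real.sqrt (n + 1) : ℂ) * (u : Fock) (n + 1)‖ ^ 2 ≤ _
    rcases le_or_gt N (n + 1) with hn | hn
    · simp [hu _ hn]
    · rw [norm_mul, mul_pow, Complex.norm_real, Real.norm_eq_abs, sq_abs,
        Real.sq_sqrt (by positivity)]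
      gcongr
      exact_mod_cast hn.le
  have := Real.sqrt_le_sqrt h
  rwa [Real.sqrt_mul (by positivity), Real.sqrt_sq (norm_nonneg _),
    Real.sqrt_sq (norm_nonneg _)] at this

theorem norm_creation_le (u : finiteFock) (N : ℕ) (hu : ∀ n, N ≤ n → (u : Fock) n = 0) :
    ‖creation u‖ ≤ Real.sqrt N * ‖u‖ := by
  have h : ‖(creation u : Fock)‖ ^ 2 ≤ N * ‖(u : Fock)‖ ^ 2 := by
    rw [norm_sq_eq, norm_sq_eq, ← tsum_mul_left, (summable_sq _).tsum_eq_zero_add]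
    have h0 : (creation u : Fock) 0 = 0 := by
      change (Real.sqrt ((0 : ℕ) : ℝ) : ℂ) * _ = 0
      simp
    rw [h0]
    simp only [norm_zero, ne_eq, OfNat.ofNat_ne_zero, not_false_eq_true, zero_pow, zero_add]
    refine ((summable_nat_add_iff 1).2 (summable_sq (creation u : Fock))).tsum_le_tsum
      (fun n => ?_) ((summable_sq (u : Fock)).mul_left (N : ℝ))
    change ‖(Real.sqrt ((n + 1 : ℕ) : ℝ) : ℂ) * (u : Fock) n‖ ^ 2 ≤ _
    rcases le_or_gt N n with hn | hn
    · simp [hu _ hn]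
    · rw [norm_mul, mul_pow, Complex.norm_real, Real.norm_eq_abs, sq_abs,
        Real.sq_sqrt (by positivity)]
      gcongr
      exact_mod_cast hn
  have := Real.sqrt_le_sqrt h
  rwa [Real.sqrt_mul (by positivity), Real.sqrt_sq (norm_nonneg _),
    Real.sqrt_sq (norm_nonneg _)] at this

theorem position_support (u : finiteFock) (N : ℕ) (hu : ∀ n, N ≤ n → (u : Fock) n = 0) :
    ∀ n, N + 1 ≤ n → (position u : Fock) n = 0 := by
  intro n hn
  change (1 / (Real.sqrt 2 : ℂ)) * ((Real.sqrt (n + 1) : ℂ) * (u : Fock) (n + 1) +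
    (Real.sqrt n : ℂ) * (u : Fock) (n - 1)) = 0
  rw [hu (n + 1) (by omega), hu (n - 1) (by omega)]
  simp

theorem norm_position_le (u : finiteFock) (N : ℕ) (hu : ∀ n, N ≤ n → (u : Fock) n = 0) :
    ‖position u‖ ≤ 2 * Real.sqrt N * ‖u‖ := by
  have h1 : ‖(1 / (Real.sqrt 2 : ℂ))‖ ≤ 1 := by
    rw [norm_div, norm_one, Complex.norm_real, Real.norm_eq_abs,
      abs_of_nonneg (Real.sqrt_nonneg _), div_le_one (by positivity)]
    exact Real.one_le_sqrt.2 (by norm_num)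
  calc ‖position u‖ = ‖(1 / (Real.sqrt 2 : ℂ))‖ * ‖annihilation u + creation u‖ :=
        norm_smul (1 / (Real.sqrt 2 : ℂ)) (annihilation u + creation u)
    _ ≤ 1 * (‖annihilation u‖ + ‖creation u‖) := by
        gcongr
        exact norm_add_le _ _
    _ ≤ 1 * (Real.sqrt N * ‖u‖ + Real.sqrt N * ‖u‖) := by
        gcongr
        · exact norm_annihilation_le u N hu
        · exact norm_creation_le u N hu
    _ = 2 * Real.sqrt N * ‖u‖ := by ring

theorem exists_support_bound (u : finiteFock) : ∃ N, ∀ n, N ≤ n → (u : Fock) n = 0 := by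
  obtain ⟨N, hN⟩ := u.2.bddAbove
  refine ⟨N + 1, fun n hn => ?_⟩
  by_contra h
  have := hN h
  omega

/-- The terms of the exponential series of `q` at a finite vector. -/
def expTerm (η : ℝ) (u : finiteFock) (j : ℕ) : Fock :=
  ((Complex.I * η) ^ j / (j.factorial : ℂ)) • (((position ^ j) u : finiteFock) : Fock)

theorem summable_norm_expTerm (η : ℝ) (u : finiteFock) :
    Summable fun j => ‖expTerm η u j‖ := by
  obtain ⟨N, hN⟩ := exists_support_bound u
  have hs : ∀ j n, N + j ≤ n → (((position ^ j) u : finiteFock) : Fock) n = 0 := by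
    intro j
    induction j with
    | zero => simpa using hN
    | succ j ih =>
      intro n hn
      rw [pow_succ', Module.End.mul_apply]
      exact position_support _ (N + j) ih n (by omega)
  have hstep : ∀ j, ‖expTerm η u (j + 1)‖ ≤
      |η| / (j + 1) * (2 * Real.sqrt (N + j : ℕ)) * ‖expTerm η u j‖ := by
    intro j
    have h := norm_position_le _ (N + j) (hs j)
    have e : ∀ i, ‖expTerm η u i‖ = |η| ^ i / i.factorial * ‖(position ^ i) u‖ := by
      intro i
      rw [expTerm, norm_smul, norm_div, norm_pow, norm_mul, Complex.norm_I, one_mul,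
        Complex.norm_real, Complex.norm_natCast, Real.norm_eq_abs]
      rfl
    rw [e, e, pow_succ' position, Module.End.mul_apply]
    calc |η| ^ (j + 1) / ((j + 1).factorial : ℝ) * ‖position ((position ^ j) u)‖
        ≤ |η| ^ (j + 1) / ((j + 1).factorial : ℝ) *
          (2 * Real.sqrt (N + j : ℕ) * ‖(position ^ j) u‖) := by gcongr
      _ = _ := by
        rw [Nat.factorial_succ]
        push_cast
        field_simp
        ring
  have hlim : Filter.Tendsto (fun j : ℕ => |η| / (j + 1) * (2 * Real.sqrt (N + j : ℕ)))
      Filter.atTop (nhds 0) := by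
    have hb : ∀ j : ℕ, |η| / (j + 1) * (2 * Real.sqrt (N + j : ℕ)) ≤
        (2 * |η| * Real.sqrt (N + 1)) * (Real.sqrt (j + 1))⁻¹ := by
      intro j
      have h1 : Real.sqrt (N + j : ℕ) ≤ Real.sqrt (N + 1) * Real.sqrt (j + 1) := by
        rw [← Real.sqrt_mul (by positivity)]
        apply Real.sqrt_le_sqrt
        push_cast
        nlinarith [mul_nonneg (Nat.cast_nonneg (α := ℝ) N) (Nat.cast_nonneg (α := ℝ) j)]
      have h2 : (0 : ℝ) < Real.sqrt (j + 1) := by positivity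
      calc |η| / (j + 1) * (2 * Real.sqrt (N + j : ℕ))
          ≤ |η| / (j + 1) * (2 * (Real.sqrt (N + 1) * Real.sqrt (j + 1))) := by gcongr
        _ = (2 * |η| * Real.sqrt (N + 1)) * (Real.sqrt (j + 1))⁻¹ := by
          have h3 : Real.sqrt (j + 1) ^ 2 = (j : ℝ) + 1 := Real.sq_sqrt (by positivity)
          rw [← h3, Real.sqrt_sq h2.le]
          field_simp
    refine squeeze_zero (fun j => by positivity) hb ?_
    have h4 : Filter.Tendsto (fun j : ℕ => (Real.sqrt ((j : ℝ) + 1))⁻¹) Filter.atTop (nhds 0) :=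
      tendsto_inv_atTop_zero.comp (Real.tendsto_sqrt_atTop.comp
        (Filter.tendsto_atTop_add_const_right _ _ tendsto_natCast_atTop_atTop))
    simpa using h4.const_mul (2 * |η| * Real.sqrt (N + 1))
  refine summable_of_ratio_norm_eventually_le (r := 1 / 2) (by norm_num) ?_
  filter_upwards [hlim.eventually_le_const (show (0 : ℝ) < 1 / 2 by norm_num)] with j hj
  rw [norm_norm, norm_norm]
  exact (hstep j).trans (by gcongr)

theorem inner_annihilation (u v : finiteFock) :
    inner ℂ (annihilation u : Fock) (v : Fock) = inner ℂ (u : Fock) (creation v : Fock) := by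
  rw [lp.inner_eq_tsum, lp.inner_eq_tsum,
    (lp.summable_inner (𝕜 := ℂ) (u : Fock) (creation v : Fock)).tsum_eq_zero_add]
  have h0 : (creation v : Fock) 0 = 0 := by
    change (Real.sqrt ((0 : ℕ) : ℝ) : ℂ) * _ = 0
    simp
  rw [h0, inner_zero_right, zero_add]
  refine tsum_congr fun n => ?_
  change inner ℂ ((Real.sqrt (n + 1) : ℂ) * (u : Fock) (n + 1)) ((v : Fock) n) =
    inner ℂ ((u : Fock) (n + 1)) ((Real.sqrt ((n + 1 : ℕ) : ℝ) : ℂ) * (v : Fock) n)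
  simp only [RCLike.inner_apply, map_mul, Complex.conj_ofReal]
  push_cast
  ring

theorem inner_position (u v : finiteFock) :
    inner ℂ (position u : Fock) (v : Fock) = inner ℂ (u : Fock) (position v : Fock) := by
  have h2 : inner ℂ (creation u : Fock) (v : Fock) =
      inner ℂ (u : Fock) (annihilation v : Fock) := by
    rw [← inner_conj_symm, ← inner_annihilation, inner_conj_symm]
  change inner ℂ ((1 / (Real.sqrt 2 : ℂ)) • ((annihilation u : Fock) + (creation u : Fock)))
      (v : Fock) = inner ℂ (u : Fock)
      ((1 / (Real.sqrt 2 : ℂ)) • ((annihilation v : Fock) + (creation v : Fock)))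
  rw [inner_smul_left, inner_smul_right, inner_add_left, inner_add_right, inner_annihilation, h2]
  simp [add_comm]

theorem inner_position_pow (j : ℕ) (u v : finiteFock) :
    inner ℂ (((position ^ j) u : finiteFock) : Fock) (v : Fock) =
      inner ℂ (u : Fock) (((position ^ j) v : finiteFock) : Fock) := by
  induction j generalizing u v with
  | zero => simp
  | succ j ih =>
    rw [pow_succ' position, Module.End.mul_apply, inner_position, ih, ← Module.End.mul_apply,
      ← pow_succ, ← pow_succ']

/-- The exponential series `∑ (iη)^j/j! q^j u` at a finite vector `u`. -/
def expSeries (η : ℝ) (u : finiteFock) : Fock := ∑' j, expTerm η u j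

theorem hasSum_expSeries (η : ℝ) (u : finiteFock) :
    HasSum (expTerm η u) (expSeries η u) :=
  (summable_norm_expTerm η u).of_norm.hasSum

theorem inner_expSeries_left (η : ℝ) (u v : finiteFock) :
    inner ℂ (expSeries η u) (v : Fock) = inner ℂ (u : Fock) (expSeries (-η) v) := by
  have h1 : HasSum (fun j => inner ℂ (u : Fock) (expTerm (-η) v j))
      (inner ℂ (u : Fock) (expSeries (-η) v)) :=
    (innerSL ℂ (u : Fock)).hasSum (hasSum_expSeries (-η) v)
  have h2 : HasSum (fun j => inner ℂ (v : Fock) (expTerm η u j))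
      (inner ℂ (v : Fock) (expSeries η u)) :=
    (innerSL ℂ (v : Fock)).hasSum (hasSum_expSeries η u)
  have h3 := Complex.hasSum_conj'.2 h2
  simp only [inner_conj_symm] at h3
  refine h3.unique ?_
  convert! h1 using 1
  funext j
  rw [expTerm, expTerm, inner_smul_left, inner_smul_right, inner_position_pow]
  have hI : (starRingEnd ℂ) (Complex.I * η) = Complex.I * ((-η : ℝ) : ℂ) := by simp
  rw [map_div₀, map_pow, hI, map_natCast]

theorem norm_expSeries (η : ℝ) (u : finiteFock) : ‖expSeries η u‖ = ‖u‖ := by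
  have hsum := summable_norm_expTerm η u
  have hprod : Summable fun x : ℕ × ℕ => inner ℂ (expTerm η u x.1) (expTerm η u x.2) := by
    refine Summable.of_norm_bounded (hsum.mul_of_nonneg hsum (fun _ => norm_nonneg _)
      (fun _ => norm_nonneg _)) fun x => norm_inner_le_norm _ _
  have h1 : inner ℂ (expSeries η u) (expSeries η u) =
      ∑' x : ℕ × ℕ, inner ℂ (expTerm η u x.1) (expTerm η u x.2) := by
    rw [hprod.tsum_prod]
    have hl : HasSum (fun j => inner ℂ (expTerm η u j) (expSeries η u))
        (inner ℂ (expSeries η u) (expSeries η u)) := by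
      have h2 := (innerSL ℂ (expSeries η u)).hasSum (hasSum_expSeries η u)
      have h3 := Complex.hasSum_conj'.2 h2
      simpa only [innerSL_apply_apply, Function.comp_def, inner_conj_symm] using h3
    rw [← hl.tsum_eq]
    refine tsum_congr fun j => ?_
    exact (((innerSL ℂ (expTerm η u j)).hasSum (hasSum_expSeries η u)).tsum_eq).symm
  have h2 : ∑' x : ℕ × ℕ, inner ℂ (expTerm η u x.1) (expTerm η u x.2) =
      inner ℂ (u : Fock) (u : Fock) := by
    rw [← Finset.HasAntidiagonal.sigmaAntidiagonalEquivProd.tsum_eq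
      (fun x : ℕ × ℕ => inner ℂ (expTerm η u x.1) (expTerm η u x.2))]
    have hs := ((Finset.HasAntidiagonal.sigmaAntidiagonalEquivProd.summable_iff).2
      hprod).tsum_sigma' (fun n => (hasSum_fintype _).summable)
    refine hs.trans ?_
    have hterm : ∀ n : ℕ, (∑' c : Finset.HasAntidiagonal.antidiagonal n,
        inner ℂ (expTerm η u c.1.1) (expTerm η u c.1.2)) =
        if n = 0 then inner ℂ (u : Fock) (u : Fock) else 0 := by
      intro n
      rw [tsum_fintype, Finset.univ_eq_attach, Finset.sum_attach (Finset.HasAntidiagonal.antidiagonal n)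
        (fun c => inner ℂ (expTerm η u c.1) (expTerm η u c.2))]
      have hc : ∀ c ∈ Finset.HasAntidiagonal.antidiagonal n, inner ℂ (expTerm η u c.1) (expTerm η u c.2) =
          (((-(Complex.I * η)) ^ c.1 * (Complex.I * η) ^ c.2 * (n.choose c.1 : ℂ))) *
            (inner ℂ (u : Fock) (((position ^ n) u : finiteFock) : Fock) / n.factorial) := by
        rintro ⟨i, j⟩ hij
        rw [Finset.HasAntidiagonal.mem_antidiagonal] at hij
        subst hij
        dsimp only
        rw [expTerm, expTerm, inner_smul_left, inner_smul_right, inner_position_pow,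
          ← Module.End.mul_apply, ← pow_add]
        have hch : ((i + j).choose i : ℂ) =
            (i + j).factorial / (i.factorial * j.factorial) := by
          rw [Nat.choose_symm_add, Nat.add_choose, Nat.cast_div (Nat.factorial_mul_factorial_dvd_factorial_add i j)
            (by exact_mod_cast (Nat.mul_pos (Nat.factorial_pos _) (Nat.factorial_pos _)).ne')]
          push_cast
          rfl
        have f1 : (i.factorial : ℂ) ≠ 0 := by exact_mod_cast i.factorial_ne_zero
        have f2 : (j.factorial : ℂ) ≠ 0 := by exact_mod_cast j.factorial_ne_zero
        have f3 : ((i + j).factorial : ℂ) ≠ 0 := by exact_mod_cast (i + j).factorial_ne_zero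
        rw [hch]
        simp only [map_div₀, map_pow, map_mul, Complex.conj_I, Complex.conj_ofReal,
          map_natCast]
        field_simp
      rw [Finset.sum_congr rfl hc, ← Finset.sum_mul]
      have hb : ∑ c ∈ Finset.HasAntidiagonal.antidiagonal n,
          ((-(Complex.I * η)) ^ c.1 * (Complex.I * η) ^ c.2 * (n.choose c.1 : ℂ)) =
          (-(Complex.I * η) + Complex.I * η) ^ n := by
        rw [(Commute.all (-(Complex.I * (η : ℂ))) (Complex.I * η)).add_pow']
        refine Finset.sum_congr rfl fun c _ => ?_
        rw [nsmul_eq_mul]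
        ring
      rw [hb, neg_add_cancel]
      rcases n with _ | n
      · simp
      · simp
    refine (tsum_congr hterm).trans ?_
    rw [tsum_ite_eq]
  have h3 : ‖expSeries η u‖ ^ 2 = ‖(u : Fock)‖ ^ 2 := by
    have h := h1.trans h2
    rw [inner_self_eq_norm_sq_to_K, inner_self_eq_norm_sq_to_K] at h
    exact_mod_cast h
  exact (sq_eq_sq₀ (norm_nonneg _) (norm_nonneg _)).1 h3

theorem dense_finiteFock : Dense (finiteFock : Set Fock) := by
  intro u
  have h : HasSum (fun n => lp.single 2 n (u n)) u := lp.hasSum_single (by norm_num) u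
  refine mem_closure_of_tendsto h (Filter.Eventually.of_forall fun s => ?_)
  refine Submodule.sum_mem _ fun n _ => ?_
  have : (lp.single 2 n (u n) : Fock) = u n • ket n := by
    rw [ket, ← lp.single_smul]
    simp
  rw [this]
  exact Submodule.smul_mem _ _ (ket_mem n)

theorem exists_expPosition (η : ℝ) : ∃ V : unitary (Fock →L[ℂ] Fock),
    ∀ u : finiteFock, (V : Fock →L[ℂ] Fock) (u : Fock) = expSeries η u := by
  have key : ∀ t : ℝ, ∃ V : Fock →L[ℂ] Fock,
      ∀ u : finiteFock, V (u : Fock) = expSeries t u := by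
    intro t
    let L : finiteFock →ₗᵢ[ℂ] Fock :=
      { toFun := expSeries t
        map_add' := fun u v => by
          refine ((hasSum_expSeries t (u + v)).unique ?_)
          convert! (hasSum_expSeries t u).add (hasSum_expSeries t v) using 1
          funext j
          simp [expTerm]
        map_smul' := fun c u => by
          refine ((hasSum_expSeries t (c • u)).unique ?_)
          convert! (hasSum_expSeries t u).const_smul c using 1
          funext j
          simp [expTerm, smul_comm c]
        norm_map' := fun u => norm_expSeries t u }
    refine ⟨L.toContinuousLinearMap.extend (Submodule.subtypeL finiteFock), fun u => ?_⟩
    exact ContinuousLinearMap.extend_eq _ dense_finiteFock.denseRange_val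
      isUniformEmbedding_subtype_val.isUniformInducing u
  obtain ⟨V, hV⟩ := key η
  obtain ⟨W, hW⟩ := key (-η)
  have iso : ∀ (t : ℝ) (T : Fock →L[ℂ] Fock), (∀ u : finiteFock, T (u : Fock) = expSeries t u) →
      star T * T = 1 := by
    intro t T hT
    refine (ContinuousLinearMap.norm_map_iff_adjoint_comp_self T).1 fun x => ?_
    refine isClosed_property (p := fun x => ‖T x‖ = ‖x‖) dense_finiteFock.denseRange_val
      (isClosed_eq (by fun_prop) (by fun_prop)) (fun u => ?_) x
    rw [hT]
    exact norm_expSeries t u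
  have hadj : star V = W := by
    refine ContinuousLinearMap.ext fun x => ?_
    refine isClosed_property (p := fun x => star V x = W x) dense_finiteFock.denseRange_val
      (isClosed_eq (by fun_prop) (by fun_prop)) (fun u => ?_) x
    refine dense_finiteFock.eq_of_inner_left ℂ fun y hy => ?_
    have e1 : inner ℂ (star V (u : Fock)) y = inner ℂ (u : Fock) (V y) :=
      ContinuousLinearMap.adjoint_inner_left V y (u : Fock)
    have e2 := inner_expSeries_left (-η) u ⟨y, hy⟩
    rw [neg_neg] at e2
    change inner ℂ (star V (u : Fock)) y = inner ℂ (W (u : Fock)) y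
    rw [e1, hW u, hV ⟨y, hy⟩]
    exact e2.symm
  refine ⟨⟨V, ?_⟩, hV⟩
  rw [Unitary.mem_iff]
  refine ⟨iso η V hV, ?_⟩
  have h := iso (-η) W hW
  rw [← hadj, star_star] at h
  exact h

/-! ### The unitaries `e^{iηq}` and `R` -/

/-- The unitary `e^{iηq}`: finite superpositions of Fock states are analytic vectors of `q`, so
it is given on them by the exponential series (see `expPosition_hasSum`), and on all of `Fock` by
continuity. -/
def expPosition (η : ℝ) : unitary (Fock →L[ℂ] Fock) := (exists_expPosition η).choose

theorem expPosition_hasSum (η : ℝ) (u : finiteFock) :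
    HasSum (fun j : ℕ => ((Complex.I * η) ^ j / (j.factorial : ℂ)) •
      (((position ^ j) u : finiteFock) : Fock)) ((expPosition η : Fock →L[ℂ] Fock) (u : Fock)) := by
  rw [expPosition, (exists_expPosition η).choose_spec u]
  exact hasSum_expSeries η u

/-- The sequence `(e^{iθn} u_n)_n`. -/
def phaseFun (θ : ℝ) (u : Fock) : Fock :=
  ⟨fun n => Complex.exp (Complex.I * θ * n) * u n, by
    refine memℓp_gen ?_
    have := (lp.hasSum_norm (p := 2) (by norm_num) u).summable
    have hn : ∀ n : ℕ, ‖Complex.exp (Complex.I * θ * n)‖ = 1 := fun n => by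
      have : Complex.I * θ * n = ((θ * n : ℝ) : ℂ) * Complex.I := by push_cast; ring
      rw [this, Complex.norm_exp_ofReal_mul_I]
    simpa [norm_mul, hn] using this⟩

theorem phaseFun_apply (θ : ℝ) (u : Fock) (n : ℕ) :
    phaseFun θ u n = Complex.exp (Complex.I * θ * n) * u n := rfl

theorem phaseFun_phaseFun_neg (θ : ℝ) (u : Fock) : phaseFun θ (phaseFun (-θ) u) = u := by
  refine lp.ext (funext fun n => ?_)
  rw [phaseFun_apply, phaseFun_apply, ← mul_assoc, ← Complex.exp_add]
  simp

theorem norm_phaseFun (θ : ℝ) (u : Fock) : ‖phaseFun θ u‖ = ‖u‖ := by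
  refine (sq_eq_sq₀ (norm_nonneg _) (norm_nonneg _)).1 ?_
  rw [norm_sq_eq, norm_sq_eq]
  refine tsum_congr fun n => ?_
  have : Complex.I * θ * n = ((θ * n : ℝ) : ℂ) * Complex.I := by push_cast; ring
  rw [phaseFun_apply, norm_mul, this, Complex.norm_exp_ofReal_mul_I, one_mul]

/-- The unitary `e^{iθ a†a}`, acting by `|n⟩ ↦ e^{iθn} |n⟩`. -/
def numberPhase (θ : ℝ) : unitary (Fock →L[ℂ] Fock) :=
  Unitary.linearIsometryEquiv.symm
    { toFun := phaseFun θ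
      invFun := phaseFun (-θ)
      left_inv := fun u => by simpa using phaseFun_phaseFun_neg (-θ) u
      right_inv := fun u => phaseFun_phaseFun_neg θ u
      map_add' := fun u v => lp.ext (funext fun n => by simp [phaseFun_apply, mul_add])
      map_smul' := fun c u => lp.ext (funext fun n => by simp [phaseFun_apply, mul_left_comm])
      norm_map' := norm_phaseFun θ }

/-- The rotation `R = e^{iπ a†a/2}`. -/
def rotation : unitary (Fock →L[ℂ] Fock) := numberPhase (Real.pi / 2)

/-! ### Truncation, trace and trace norm -/

/-- The orthogonal projector `∑_{i ≤ N} |i⟩⟨i|` onto `span {|0⟩, …, |N⟩}`. -/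
def proj (N : ℕ) : Fock →L[ℂ] Fock :=
  ∑ i ∈ Finset.range (N + 1), InnerProductSpace.rankOne ℂ (ket i) (ket i)

/-- The trace `∑ ⟨n|X|n⟩` (meaningful for trace-class `X`). -/
def trace (X : Fock →L[ℂ] Fock) : ℂ := ∑' n, inner ℂ (ket n) (X (ket n))

/-- The square root of a positive operator on a Hilbert space. -/
def opSqrt {H : Type*} [NormedAddCommGroup H] [InnerProductSpace ℂ H] [CompleteSpace H]
    (Y : H →L[ℂ] H) : H →L[ℂ] H := CFC.sqrt Y

/-- `Tr √Y ∈ [0, ∞]` for a positive semidefinite operator `Y`. -/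
def traceSqrt (Y : Fock →L[ℂ] Fock) : ℝ≥0∞ :=
  ∑' n, ENNReal.ofReal (inner ℂ (ket n) (opSqrt Y (ket n))).re

/-- The trace norm `‖X‖₁ = Tr √(X†X) ∈ [0, ∞]`; `X` is trace class iff it is finite. -/
def traceNorm (X : Fock →L[ℂ] Fock) : ℝ≥0∞ := traceSqrt (star X * X)

/-! ### Unbounded operators and the Lindbladian -/

/-- The composition `S T` of unbounded operators, on its natural domain
`{x ∈ dom T | T x ∈ dom S}`. -/
def comp (S T : Fock →ₗ.[ℂ] Fock) : Fock →ₗ.[ℂ] Fock where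
  domain := (S.domain.comap T.toFun).map T.domain.subtype
  toFun :=
    { toFun := fun x => S ⟨T ⟨x, by
          obtain ⟨y, _, hy⟩ := x.2
          exact hy ▸ y.2⟩, by
        obtain ⟨x, y, hy, rfl⟩ := x
        exact hy⟩
      map_add' := fun x y => by
        rw [← S.map_add]
        congr 1
        exact Subtype.ext (T.map_add ⟨x, _⟩ ⟨y, _⟩)
      map_smul' := fun c x => by
        rw [RingHom.id_apply, ← S.map_smul]
        congr 1
        exact Subtype.ext (T.map_smul c ⟨x, _⟩) }

/-- A bounded operator seen as an operator with full domain. -/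
def ofBounded (X : Fock →L[ℂ] Fock) : Fock →ₗ.[ℂ] Fock := X.toLinearMap.toPMap ⊤

/-- The dissipator `D_Γ(ρ) = Γ ρ Γ† - ½ (Γ† Γ ρ + ρ Γ† Γ)` for an unbounded operator `Γ` and a
bounded operator `ρ`, with the natural domains of sums and products. -/
def dissipator (Γ : Fock →ₗ.[ℂ] Fock) (ρ : Fock →L[ℂ] Fock) : Fock →ₗ.[ℂ] Fock :=
  comp Γ (comp (ofBounded ρ) Γ.adjoint) -
    (1 / 2 : ℂ) • (comp Γ.adjoint (comp Γ (ofBounded ρ)) +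
      comp (ofBounded ρ) (comp Γ.adjoint Γ))

/-- The operator `Γ₀ = 𝒜 e^{iηq} (Id - εp) - Id`, on the core `finiteFock`. -/
def jumpZero (𝒜 η ε : ℝ) : Fock →ₗ.[ℂ] Fock where
  domain := finiteFock
  toFun := (expPosition η : Fock →L[ℂ] Fock).toLinearMap ∘ₗ finiteFock.subtype ∘ₗ
    ((𝒜 : ℂ) • (1 - (ε : ℂ) • momentum)) - finiteFock.subtype

/-- The operator `Γ_k = R^k Γ₀ R^{-k}`. -/
def jump (𝒜 η ε : ℝ) (k : ℕ) : Fock →ₗ.[ℂ] Fock :=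
  comp (ofBounded (rotation ^ k : unitary (Fock →L[ℂ] Fock)))
    (comp (jumpZero 𝒜 η ε) (ofBounded (rotation⁻¹ ^ k : unitary (Fock →L[ℂ] Fock))))

/-- The GKP Lindbladian `L(ρ) = ∑_{k=0}^{3} D_{Γ_k}(ρ)`. -/
def lindbladian (𝒜 η ε : ℝ) (ρ : Fock →L[ℂ] Fock) : Fock →ₗ.[ℂ] Fock :=
  ∑ k ∈ Finset.range 4, dissipator (jump 𝒜 η ε k) ρ

/-- The truncated GKP Lindbladian `L_N(ρ) = ∑_{k=0}^{3} D_{P_N Γ_k P_N}(ρ)`. -/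
def lindbladianTrunc (𝒜 η ε : ℝ) (N : ℕ) (ρ : Fock →L[ℂ] Fock) : Fock →ₗ.[ℂ] Fock :=
  ∑ k ∈ Finset.range 4,
    dissipator (comp (ofBounded (proj N)) (comp (jump 𝒜 η ε k) (ofBounded (proj N)))) ρ

/-- `T` is densely defined and `X` is its (necessarily unique) bounded extension. -/
def IsBoundedExtension (T : Fock →ₗ.[ℂ] Fock) (X : Fock →L[ℂ] Fock) : Prop :=
  Dense (T.domain : Set Fock) ∧ ∀ x : T.domain, X (x : Fock) = T x

/-! ### The estimator -/

/-- The bounded operator `T P_N`, for `T` a polynomial in `a` and `a†`. -/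
def onTrunc (T : Module.End ℂ finiteFock) (N : ℕ) : Fock →L[ℂ] Fock :=
  ∑ i ∈ Finset.range (N + 1), InnerProductSpace.rankOne ℂ (T (ketF i) : Fock) (ket i)

/-- The operator `Q = 𝒜 (Id - εp)` on `finiteFock`; it is symmetric there, so `Q†Q = Q²`. -/
def polyQ (𝒜 ε : ℝ) : Module.End ℂ finiteFock := (𝒜 : ℂ) • (1 - (ε : ℂ) • momentum)

/-- The operator `(1 + εη) Id - εp = e^{iηq} (Id - εp) e^{-iηq}` on `finiteFock`. -/
def polyS (η ε : ℝ) : Module.End ℂ finiteFock :=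
  (1 + (ε : ℂ) * (η : ℂ)) • 1 - (ε : ℂ) • momentum

/-- The truncation `U_{N+1} = P_{N+1} e^{iηq} P_{N+1}`. -/
def expTrunc (η : ℝ) (N : ℕ) : Fock →L[ℂ] Fock :=
  proj (N + 1) * (expPosition η : Fock →L[ℂ] Fock) * proj (N + 1)

/-- The estimator `f(ρ)` for `ρ = P_N ρ P_N`, with `P = P_N`, `P^⊥ = Id - P` and `U = e^{iηq}`:
`Tr(QρQ†) - Tr(P U QρQ† U† P) + 2 ‖P^⊥ U QρQ† U† P‖₁`
`+ ‖(Q†Q - P Q† U_{N+1}† P U_{N+1} Q P) ρ‖₁ + ‖P^⊥ U Q ρ‖₁`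
`+ |𝒜| ‖P^⊥ U† ((1 + εη) Id - εp) ρ‖₁`.
Below `Q` stands for the bounded operator `Q P_N`; note `Q ρ = (Q P_N) ρ`. -/
def estimator (𝒜 η ε : ℝ) (N : ℕ) (ρ : Fock →L[ℂ] Fock) : ℝ :=
  let P := proj N
  let U : Fock →L[ℂ] Fock := expPosition η
  let U₁ := expTrunc η N
  let Q := onTrunc (polyQ 𝒜 ε) N
  let QQ := onTrunc (polyQ 𝒜 ε * polyQ 𝒜 ε) N
  let S := onTrunc (polyS η ε) N
  (trace (Q * ρ * star Q)).re - (trace (P * U * Q * ρ * star Q * star U * P)).re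
    + 2 * (traceNorm ((1 - P) * U * Q * ρ * star Q * star U * P)).toReal
    + (traceNorm ((QQ - star Q * star U₁ * P * U₁ * Q) * ρ)).toReal
    + (traceNorm ((1 - P) * U * Q * ρ)).toReal
    + |𝒜| * (traceNorm ((1 - P) * star U * S * ρ)).toReal

/-- The finite-dimensional expression of the estimator: `e^{iηq}` enters only through its
truncation `U_{N+1}`. -/
def estimatorTrunc (𝒜 η ε : ℝ) (N : ℕ) (ρ : Fock →L[ℂ] Fock) : ℝ :=
  let P := proj N
  let P₁ := proj (N + 1)
  let U₁ := expTrunc η N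
  let Q := onTrunc (polyQ 𝒜 ε) N
  let QQ := onTrunc (polyQ 𝒜 ε * polyQ 𝒜 ε) N
  let S := onTrunc (polyS η ε) N
  let M := Q * ρ * star Q * star U₁ * P
  (trace (Q * ρ * star Q)).re - (trace (P * U₁ * Q * ρ * star Q * star U₁ * P)).re
    + 2 * (traceSqrt (star M * (P₁ - star U₁ * P * U₁) * M)).toReal
    + (traceNorm ((QQ - star Q * star U₁ * P * U₁ * Q) * ρ)).toReal
    + (traceSqrt (star (Q * ρ) * (P₁ - star U₁ * P * U₁) * (Q * ρ))).toReal
    + |𝒜| * (traceSqrt (star (S * ρ) * (P₁ - U₁ * P * star U₁) * (S * ρ))).toReal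

end GKP

end

noncomputable section

namespace GKP

/-! ### The trace norm -/

/-! Write `P = P_N`. Since `P` commutes with `R`, conjugating by `R^k` turns the `k`-th dissipator
defect at `ρ` into the one for `Γ₀` at `σ = R^{-k} ρ R^k`. On such a `σ` the unbounded operators act
through bounded ones: `Γ₀ P = W - P` with `W = U Q P`, and `Γ₀† Γ₀ P = D - W - T + P` with `D = Q²
P` and `T = 𝒜 U† S P`. The last formula rests on `Q U† = 𝒜 U† S`, a consequence of `[p, q] = -i`; it
is proved weakly, against finite vectors, because `U` need not preserve the core
(`inner_polyS_expPosition`, `inner_jumpSqTrunc`).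

The relation `P T = W† P` cancels the blocks of the defect that truncation does not lose. With `B =
W σ W†`, what remains is `B - P B P` and the self-adjoint parts, up to sign, of `(1 - P) W σ`, `(D -
W† P W) σ` and `(1 - P) T σ` (`truncationDefect_eq`). Split `B - P B P` into its corner `(1 - P) B
(1 - P)` and two mutually adjoint off-diagonal blocks. As `B ≥ 0`, the corner has trace norm `Tr B -
Tr P B P`, and `Tr B ≤ Tr Q σ Q†`. The triangle inequality gives `f`.

Triangle inequality and ideal property of the trace norm come from a duality: `∑ |⟨n|C X D|n⟩| ≤
‖X‖₁` for contractions `C`, `D`, and some contraction `V` satisfies `‖X‖₁ ≤ ∑ |⟨n|V X|n⟩|`.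

For the finite-dimensional form, `Q` and `S` raise the Fock level by at most one, so `U` and `U†`
are applied only to vectors of `H_{N+1}`, and `(1 - P)` is eliminated through `Y† (1 - U† P U) Y`.
-/

theorem norm_apply_le_of_norm_le_one {H : Type*} [NormedAddCommGroup H]
    [InnerProductSpace ℂ H] {A : H →L[ℂ] H} (hA : ‖A‖ ≤ 1) (u : H) : ‖A u‖ ≤ ‖u‖ :=
  (A.le_of_opNorm_le hA u).trans_eq (one_mul _)

/-! ### Square roots and contractive factorization of bounded operators. -/

section General

variable {H : Type*} [NormedAddCommGroup H] [InnerProductSpace ℂ H] [CompleteSpace H]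

theorem opSqrt_nonneg (Y : H →L[ℂ] H) : 0 ≤ opSqrt Y := CFC.sqrt_nonneg Y

theorem opSqrt_mul_opSqrt {Y : H →L[ℂ] H} (hY : 0 ≤ Y) : opSqrt Y * opSqrt Y = Y :=
  CFC.sqrt_mul_sqrt_self Y hY

theorem opSqrt_mul_self {Y : H →L[ℂ] H} (hY : 0 ≤ Y) : opSqrt (Y * Y) = Y :=
  CFC.sqrt_mul_self Y hY

theorem star_opSqrt (Y : H →L[ℂ] H) : star (opSqrt Y) = opSqrt Y :=
  (opSqrt_nonneg Y).isSelfAdjoint.star_eq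

theorem star_eq_of_nonneg {Y : H →L[ℂ] H} (hY : 0 ≤ Y) : star Y = Y :=
  hY.isSelfAdjoint.star_eq

theorem norm_star_eq (A : H →L[ℂ] H) : ‖star A‖ = ‖A‖ := norm_star A

theorem star_mul_self_nonneg' (X : H →L[ℂ] H) : 0 ≤ star X * X := star_mul_self_nonneg X

theorem norm_mul_le_one {A B : H →L[ℂ] H} (hA : ‖A‖ ≤ 1) (hB : ‖B‖ ≤ 1) : ‖A * B‖ ≤ 1 :=
  (norm_mul_le A B).trans (mul_le_one₀ hA (norm_nonneg _) hB)

theorem star_mul_eq (A B : H →L[ℂ] H) : star (A * B) = star B * star A := star_mul A B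

theorem inner_star_left (A : H →L[ℂ] H) (u v : H) : inner ℂ (star A u) v = inner ℂ u (A v) :=
  ContinuousLinearMap.adjoint_inner_left A v u

theorem inner_star_right (A : H →L[ℂ] H) (u v : H) : inner ℂ u (star A v) = inner ℂ (A u) v :=
  ContinuousLinearMap.adjoint_inner_right A u v

theorem inner_opSqrt {S : H →L[ℂ] H} (hS : 0 ≤ S) (u v : H) :
    inner ℂ (opSqrt S u) (opSqrt S v) = inner ℂ u (S v) := by
  rw [← inner_star_right, star_opSqrt]
  exact congrArg (fun A : H →L[ℂ] H => inner ℂ u (A v)) (opSqrt_mul_opSqrt hS)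

/-- If `‖S u‖ ≤ ‖T u‖` for all `u`, then `S` factors through `T` by a contraction. -/
theorem exists_contraction_mul_eq {S T : H →L[ℂ] H} (h : ∀ u, ‖S u‖ ≤ ‖T u‖) :
    ∃ V : H →L[ℂ] H, ‖V‖ ≤ 1 ∧ V * T = S := by
  let K : Submodule ℂ H := (LinearMap.range T.toLinearMap).topologicalClosure
  have : CompleteSpace K := (Submodule.isClosed_topologicalClosure _).completeSpace_coe
  let e : H →ₗ[ℂ] K := T.toLinearMap.codRestrict K fun u =>
    Submodule.le_topologicalClosure _ ⟨u, rfl⟩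
  have hd : DenseRange e := by
    intro x
    rw [Topology.IsInducing.subtypeVal.closure_eq_preimage_closure_image]
    have hx : (x : H) ∈ closure (LinearMap.range T.toLinearMap : Set H) := x.2
    refine closure_mono ?_ hx
    rintro _ ⟨u, rfl⟩
    exact ⟨e u, ⟨u, rfl⟩, rfl⟩
  have hn : ∀ u, ‖S.toLinearMap u‖ ≤ 1 * ‖e u‖ := fun u => by
    rw [one_mul]
    exact h u
  -- The rule `T u ↦ S u` is well defined and contractive on the range of `T` and extends to its
  -- closure `K`; projecting onto `K` first makes it global without increasing the norm.
  refine ⟨(S.toLinearMap.extendOfNorm e) ∘L K.orthogonalProjectionOnto, ?_, ?_⟩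
  · refine (ContinuousLinearMap.opNorm_comp_le _ _).trans ?_
    exact mul_le_one₀ (LinearMap.opNorm_extendOfNorm_le hd zero_le_one hn)
      (ContinuousLinearMap.opNorm_nonneg _) K.orthogonalProjectionOnto_norm_le
  · refine ContinuousLinearMap.ext fun u => ?_
    have h1 : K.orthogonalProjectionOnto (T u) = e u :=
      K.orthogonalProjectionOnto_mem_subspace_eq_self (e u)
    change S.toLinearMap.extendOfNorm e (K.orthogonalProjectionOnto (T u)) = S u
    rw [h1, LinearMap.extendOfNorm_eq hd ⟨1, hn⟩]
    rfl

end General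

/-! ### Fock matrix elements and duality for the trace norm. -/

theorem inner_ket (n : ℕ) (u : Fock) : inner ℂ (ket n) u = u n := by
  simp [ket, lp.inner_single_left]

theorem ket_apply (n m : ℕ) : ket n m = if m = n then 1 else 0 := by
  rw [ket, lp.single_apply, Pi.single_apply]

theorem tsum_enorm_sq (u : Fock) : ∑' n, ‖u n‖ₑ ^ 2 = ‖u‖ₑ ^ 2 := by
  have h : ∀ z : ℝ, 0 ≤ z → ENNReal.ofReal z ^ 2 = ENNReal.ofReal (z ^ 2) := fun z hz =>
    (ENNReal.ofReal_pow hz 2).symm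
  simp_rw [← ofReal_norm, h _ (norm_nonneg _)]
  rw [norm_sq_eq, ENNReal.ofReal_tsum_of_nonneg (fun _ => by positivity) (summable_sq u)]

theorem enorm_apply_eq_of_adjoint (A : Fock →L[ℂ] Fock) (m n : ℕ) :
    ‖A (ket n) m‖ₑ = ‖star A (ket m) n‖ₑ := by
  rw [← inner_ket, ← inner_ket, ← enorm_norm, ← enorm_norm (inner ℂ (ket n) _),
    ← norm_inner_symm]
  congr 2
  rw [inner_star_right]

/-- Both sides are the sum of all squared matrix entries, in the two orders of summation: this is
the adjoint invariance of the Hilbert–Schmidt norm. -/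
theorem tsum_enorm_sq_adjoint (A : Fock →L[ℂ] Fock) :
    ∑' n, ‖A (ket n)‖ₑ ^ 2 = ∑' n, ‖star A (ket n)‖ₑ ^ 2 := by
  simp_rw [← tsum_enorm_sq]
  rw [ENNReal.tsum_comm]
  simp_rw [enorm_apply_eq_of_adjoint A]

theorem enorm_apply_le_of_norm_le_one {C : Fock →L[ℂ] Fock} (hC : ‖C‖ ≤ 1) (u : Fock) :
    ‖C u‖ₑ ≤ ‖u‖ₑ := by
  rw [← ofReal_norm, ← ofReal_norm]
  exact ENNReal.ofReal_le_ofReal (norm_apply_le_of_norm_le_one hC u)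

/-- After passing to adjoints the contraction acts on the left, where it shrinks every term. -/
theorem tsum_enorm_sq_mul_le (A : Fock →L[ℂ] Fock) {C : Fock →L[ℂ] Fock} (hC : ‖C‖ ≤ 1) :
    ∑' n, ‖(A * C) (ket n)‖ₑ ^ 2 ≤ ∑' n, ‖A (ket n)‖ₑ ^ 2 := by
  rw [tsum_enorm_sq_adjoint, tsum_enorm_sq_adjoint A, star_mul_eq]
  refine ENNReal.tsum_le_tsum fun n => ?_
  gcongr
  exact enorm_apply_le_of_norm_le_one ((norm_star_eq C).trans_le hC) _

theorem ofReal_re_inner {S : Fock →L[ℂ] Fock} (hS : 0 ≤ S) (u : Fock) :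
    ENNReal.ofReal (inner ℂ u (S u)).re = ‖opSqrt S u‖ₑ ^ 2 := by
  rw [← inner_opSqrt hS, inner_self_eq_norm_sq_to_K, ← ofReal_norm,
    ← ENNReal.ofReal_pow (norm_nonneg _)]
  norm_cast

/-- With `T = √S` each entry is `⟨T C† n, T D n⟩`. By `2ab ≤ a² + b²` twice the sum is at most two
Hilbert–Schmidt sums, each bounded by that of `T`, which is `Tr S`. -/
theorem tsum_enorm_inner_le {S C D : Fock →L[ℂ] Fock} (hS : 0 ≤ S) (hC : ‖C‖ ≤ 1)
    (hD : ‖D‖ ≤ 1) :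
    ∑' n, ‖inner ℂ (ket n) ((C * S * D) (ket n))‖ₑ ≤
      ∑' n, ENNReal.ofReal (inner ℂ (ket n) (S (ket n))).re := by
  set T := opSqrt S with hT
  have hterm : ∀ n, 2 * ‖inner ℂ (ket n) ((C * S * D) (ket n))‖ₑ ≤
      ‖(T * star C) (ket n)‖ₑ ^ 2 + ‖(T * D) (ket n)‖ₑ ^ 2 := by
    intro n
    have h1 : inner ℂ (ket n) ((C * S * D) (ket n)) =
        inner ℂ ((T * star C) (ket n)) ((T * D) (ket n)) := by
      change inner ℂ (ket n) (C (S (D (ket n)))) = inner ℂ (T (star C (ket n))) (T (D (ket n)))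
      rw [inner_opSqrt hS, inner_star_left]
    have h2 : 2 * ‖inner ℂ (ket n) ((C * S * D) (ket n))‖ ≤
        ‖(T * star C) (ket n)‖ ^ 2 + ‖(T * D) (ket n)‖ ^ 2 := by
      rw [h1]
      have := norm_inner_le_norm (𝕜 := ℂ) ((T * star C) (ket n)) ((T * D) (ket n))
      nlinarith [sq_nonneg (‖(T * star C) (ket n)‖ - ‖(T * D) (ket n)‖)]
    have h3 := ENNReal.ofReal_le_ofReal h2
    rwa [ENNReal.ofReal_mul (by norm_num), ENNReal.ofReal_add (by positivity) (by positivity),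
      ENNReal.ofReal_pow (norm_nonneg _), ENNReal.ofReal_pow (norm_nonneg _), ofReal_norm,
      ofReal_norm, ofReal_norm, ENNReal.ofReal_ofNat] at h3
  have h := ENNReal.tsum_le_tsum hterm
  rw [ENNReal.tsum_mul_left, ENNReal.tsum_add] at h
  simp_rw [ofReal_re_inner hS]
  refine (ENNReal.mul_le_mul_iff_right (a := 2) (by simp) (by simp)).1 (h.trans ?_)
  rw [two_mul]
  exact add_le_add (tsum_enorm_sq_mul_le T (by rwa [norm_star_eq])) (tsum_enorm_sq_mul_le T hD)

/-- Equality of norms lets `exists_contraction_mul_eq` factor `X` through `|X|` and `|X|` through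
`X`, in place of the polar decomposition. -/
theorem norm_opSqrt_star_mul_apply (X : Fock →L[ℂ] Fock) (u : Fock) :
    ‖opSqrt (star X * X) u‖ = ‖X u‖ := by
  have h := (inner_opSqrt (star_mul_self_nonneg' X) u u).symm
  have h2 : inner ℂ u ((star X * X) u) = inner ℂ (X u) (X u) := by
    change inner ℂ u (star X (X u)) = _
    rw [inner_star_right]
  rw [h2, inner_self_eq_norm_sq_to_K, inner_self_eq_norm_sq_to_K] at h
  exact ((sq_eq_sq₀ (norm_nonneg _) (norm_nonneg _)).1 (by exact_mod_cast h)).symm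

/-- Upper half of the duality: `X = V |X|` with `V` a contraction, which is absorbed into `C`. -/
theorem tsum_enorm_inner_mul_le_traceNorm (X : Fock →L[ℂ] Fock) {C D : Fock →L[ℂ] Fock}
    (hC : ‖C‖ ≤ 1) (hD : ‖D‖ ≤ 1) :
    ∑' n, ‖inner ℂ (ket n) ((C * X * D) (ket n))‖ₑ ≤ traceNorm X := by
  obtain ⟨V, hV, hVX⟩ := exists_contraction_mul_eq
    (S := X) (T := opSqrt (star X * X)) fun u => (norm_opSqrt_star_mul_apply X u).ge
  have h := tsum_enorm_inner_le (opSqrt_nonneg (star X * X)) (C := C * V) (D := D)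
    (norm_mul_le_one hC hV) hD
  rwa [mul_assoc C V, hVX] at h

/-- Lower half of the duality, from `|X| = V X`. Norm inequalities are thereby reduced to termwise
ones. -/
theorem exists_traceNorm_le_tsum (X : Fock →L[ℂ] Fock) : ∃ V : Fock →L[ℂ] Fock, ‖V‖ ≤ 1 ∧
    traceNorm X ≤ ∑' n, ‖inner ℂ (ket n) ((V * X) (ket n))‖ₑ := by
  obtain ⟨V, hV, hVX⟩ := exists_contraction_mul_eq
    (S := opSqrt (star X * X)) (T := X) fun u => (norm_opSqrt_star_mul_apply X u).le
  refine ⟨V, hV, ENNReal.tsum_le_tsum fun n => ?_⟩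
  rw [hVX, ← ofReal_norm]
  exact ENNReal.ofReal_le_ofReal (Complex.re_le_norm _)

theorem traceNorm_mul_mul_le (X : Fock →L[ℂ] Fock) {C D : Fock →L[ℂ] Fock}
    (hC : ‖C‖ ≤ 1) (hD : ‖D‖ ≤ 1) : traceNorm (C * X * D) ≤ traceNorm X := by
  obtain ⟨V, hV, h⟩ := exists_traceNorm_le_tsum (C * X * D)
  refine h.trans ?_
  rw [← mul_assoc, ← mul_assoc]
  exact tsum_enorm_inner_mul_le_traceNorm X
    (norm_mul_le_one hV hC) hD

/-- Here `X† = |X| W†`, so the sum for `V X†` is one for `|X|` between two contractions. -/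
theorem traceNorm_star_le (X : Fock →L[ℂ] Fock) : traceNorm (star X) ≤ traceNorm X := by
  obtain ⟨V, hV, h⟩ := exists_traceNorm_le_tsum (star X)
  obtain ⟨W, hW, hWX⟩ := exists_contraction_mul_eq
    (S := X) (T := opSqrt (star X * X)) fun u => (norm_opSqrt_star_mul_apply X u).ge
  have hs : star X = opSqrt (star X * X) * star W := by
    conv_lhs => rw [← hWX, star_mul, star_opSqrt]
  refine h.trans ?_
  have h2 := tsum_enorm_inner_le (opSqrt_nonneg (star X * X)) (C := V) (D := star W) hV
    (by rwa [norm_star_eq])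
  rwa [mul_assoc, ← hs] at h2

theorem traceNorm_star (X : Fock →L[ℂ] Fock) : traceNorm (star X) = traceNorm X :=
  le_antisymm (traceNorm_star_le X) (by simpa using traceNorm_star_le (star X))

theorem traceNorm_add_le (X Y : Fock →L[ℂ] Fock) :
    traceNorm (X + Y) ≤ traceNorm X + traceNorm Y := by
  obtain ⟨V, hV, h⟩ := exists_traceNorm_le_tsum (X + Y)
  have h1 : ‖(1 : Fock →L[ℂ] Fock)‖ ≤ 1 := ContinuousLinearMap.norm_id_le
  have hX := tsum_enorm_inner_mul_le_traceNorm X hV h1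
  have hY := tsum_enorm_inner_mul_le_traceNorm Y hV h1
  rw [mul_one] at hX hY
  refine h.trans (le_trans ?_ (add_le_add hX hY))
  rw [← ENNReal.tsum_add]
  refine ENNReal.tsum_le_tsum fun n => ?_
  rw [mul_add, add_apply, inner_add_right]
  exact enorm_add_le _ _

theorem traceNorm_smul_le (c : ℂ) (X : Fock →L[ℂ] Fock) :
    traceNorm (c • X) ≤ ‖c‖ₑ * traceNorm X := by
  obtain ⟨V, hV, h⟩ := exists_traceNorm_le_tsum (c • X)
  have h1 : ‖(1 : Fock →L[ℂ] Fock)‖ ≤ 1 := ContinuousLinearMap.norm_id_le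
  have hX := tsum_enorm_inner_mul_le_traceNorm X hV h1
  rw [mul_one] at hX
  refine h.trans (le_trans (le_of_eq ?_) (mul_le_mul_right hX ‖c‖ₑ))
  rw [← ENNReal.tsum_mul_left]
  refine tsum_congr fun n => ?_
  rw [mul_smul_comm, smul_apply, inner_smul_right, enorm_mul]

theorem traceNorm_sum_le {ι : Type*} (s : Finset ι) (X : ι → Fock →L[ℂ] Fock) :
    traceNorm (∑ i ∈ s, X i) ≤ ∑ i ∈ s, traceNorm (X i) := by
  classical
  induction s using Finset.induction_on with
  -- Homogeneity with the scalar `0` gives `‖0‖₁ ≤ 0`.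
  | empty => simpa using traceNorm_smul_le 0 0
  | insert i s hi ih =>
    rw [Finset.sum_insert hi, Finset.sum_insert hi]
    exact (traceNorm_add_le _ _).trans (add_le_add_right ih _)

theorem traceNorm_of_nonneg {S : Fock →L[ℂ] Fock} (hS : 0 ≤ S) :
    traceNorm S = ∑' n, ENNReal.ofReal (inner ℂ (ket n) (S (ket n))).re := by
  rw [traceNorm, traceSqrt, star_eq_of_nonneg hS, opSqrt_mul_self hS]

/-- Finiteness supplies the summability without which the complex sum `trace` would take its default
value `0`. -/
theorem re_trace_of_nonneg {S : Fock →L[ℂ] Fock} (hS : 0 ≤ S) (hfin : traceNorm S ≠ ⊤) :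
    (trace S).re = (traceNorm S).toReal := by
  have hpos : ∀ n, 0 ≤ (inner ℂ (ket n) (S (ket n)) : ℂ).re := fun n =>
    ((ContinuousLinearMap.nonneg_iff_isPositive S).1 hS).re_inner_nonneg_right (ket n)
  have h1 : ∑' n, ‖inner ℂ (ket n) (S (ket n))‖ₑ ≤ traceNorm S := by
    have := tsum_enorm_inner_mul_le_traceNorm S (C := 1) (D := 1)
      ContinuousLinearMap.norm_id_le ContinuousLinearMap.norm_id_le
    simpa using this
  have hsum : Summable fun n => (inner ℂ (ket n) (S (ket n)) : ℂ) :=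
    Summable.of_enorm (ne_top_of_le_ne_top hfin h1)
  rw [trace, Complex.re_tsum hsum, traceNorm_of_nonneg hS, ENNReal.tsum_toReal_eq (by simp)]
  exact tsum_congr fun n => (ENNReal.toReal_ofReal (hpos n)).symm

theorem traceNorm_mul_ne_top (A B : Fock →L[ℂ] Fock) {X : Fock →L[ℂ] Fock}
    (hX : traceNorm X ≠ ⊤) : traceNorm (A * X * B) ≠ ⊤ := by
  -- Every bounded factor is a scalar times a contraction, so the contractive ideal property
  -- applies.
  have key : ∀ A : Fock →L[ℂ] Fock, ∃ (c : ℂ) (C : Fock →L[ℂ] Fock), ‖C‖ ≤ 1 ∧ A = c • C := by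
    intro A
    rcases eq_or_ne A 0 with rfl | hA
    · exact ⟨0, 0, by simp, by simp⟩
    · have h : (‖A‖ : ℂ) ≠ 0 := by exact_mod_cast norm_ne_zero_iff.2 hA
      refine ⟨‖A‖, (‖A‖ : ℂ)⁻¹ • A, ?_, by rw [smul_inv_smul₀ h]⟩
      rw [norm_smul, norm_inv, Complex.norm_real, norm_norm,
        inv_mul_cancel₀ (norm_ne_zero_iff.2 hA)]
  obtain ⟨a, A', hA', rfl⟩ := key A
  obtain ⟨b, B', hB', rfl⟩ := key B
  rw [smul_mul_assoc, smul_mul_assoc, mul_smul_comm, smul_smul]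
  exact ne_top_of_le_ne_top (ENNReal.mul_ne_top enorm_ne_top
    (ne_top_of_le_ne_top hX (traceNorm_mul_mul_le X hA' hB'))) (traceNorm_smul_le _ _)

/-! ### The truncation projector -/

theorem proj_apply (N : ℕ) (u : Fock) (n : ℕ) : proj N u n = if n ≤ N then u n else 0 := by
  have h : proj N u = ∑ i ∈ Finset.range (N + 1), u i • ket i := by
    simp [proj, inner_ket]
  rw [h, lp.coeFn_sum, Finset.sum_apply]
  simp only [lp.coeFn_smul, Pi.smul_apply, ket_apply, smul_eq_mul, mul_ite, mul_one, mul_zero,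
    Finset.sum_ite_eq, Finset.mem_range, Nat.lt_succ_iff]

theorem proj_mul_proj_of_le {M N : ℕ} (h : M ≤ N) : proj N * proj M = proj M := by
  refine ContinuousLinearMap.ext fun u => lp.ext (funext fun n => ?_)
  change proj N (proj M u) n = proj M u n
  rw [proj_apply, proj_apply]
  split_ifs <;> first | rfl | omega

theorem proj_mul_proj_of_ge {M N : ℕ} (h : N ≤ M) : proj N * proj M = proj N := by
  refine ContinuousLinearMap.ext fun u => lp.ext (funext fun n => ?_)
  change proj N (proj M u) n = proj N u n
  rw [proj_apply, proj_apply, proj_apply]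
  split_ifs <;> first | rfl | omega

theorem proj_mul_self (N : ℕ) : proj N * proj N = proj N := proj_mul_proj_of_le le_rfl

theorem proj_proj (N : ℕ) (u : Fock) : proj N (proj N u) = proj N u :=
  DFunLike.congr_fun (proj_mul_self N) u

theorem proj_nonneg (N : ℕ) : 0 ≤ proj N := by
  rw [ContinuousLinearMap.nonneg_iff_isPositive]
  exact ContinuousLinearMap.isPositive_sum _ fun i _ => InnerProductSpace.isPositive_rankOne_self _

theorem star_proj (N : ℕ) : star (proj N) = proj N := star_eq_of_nonneg (proj_nonneg N)

theorem inner_proj_left (N : ℕ) (u v : Fock) :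
    inner ℂ (proj N u) v = inner ℂ u (proj N v) := by
  conv_lhs => rw [← star_proj, inner_star_left]

theorem star_one_sub_eq {H : Type*} [NormedAddCommGroup H] [InnerProductSpace ℂ H]
    [CompleteSpace H] {A : H →L[ℂ] H} (h1 : star A = A) : star (1 - A) = 1 - A := by
  rw [star_sub, star_one, h1]

theorem proj_ket (N n : ℕ) : proj N (ket n) = if n ≤ N then ket n else 0 := by
  refine lp.ext (funext fun m => ?_)
  rw [proj_apply, ket_apply]
  by_cases hn : n ≤ N
  · rw [if_pos hn, ket_apply]
    split_ifs <;> first | rfl | omega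
  · rw [if_neg hn, lp.coeFn_zero, Pi.zero_apply]
    split_ifs <;> first | rfl | omega

theorem traceNorm_proj_ne_top (N : ℕ) : traceNorm (proj N) ≠ ⊤ := by
  rw [traceNorm_of_nonneg (proj_nonneg N), tsum_eq_sum (s := Finset.range (N + 1))]
  · exact ENNReal.sum_ne_top.2 fun _ _ => ENNReal.ofReal_ne_top
  · intro n hn
    rw [proj_ket, if_neg (by simpa [Nat.lt_succ_iff] using hn), inner_zero_right]
    simp

/-- In this form, membership in the core visibly passes through operators that commute with every
`P_N`. -/
theorem mem_finiteFock_iff {u : Fock} : u ∈ finiteFock ↔ ∃ N, proj N u = u := by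
  constructor
  · intro hu
    obtain ⟨N, hN⟩ := exists_support_bound ⟨u, hu⟩
    refine ⟨N, lp.ext (funext fun n => ?_)⟩
    rw [proj_apply]
    split_ifs with h
    · rfl
    · exact (hN n (by omega)).symm
  · rintro ⟨N, hN⟩
    refine (Set.finite_Iic N).subset fun n hn => ?_
    by_contra h
    refine hn ?_
    rw [← hN, proj_apply]
    exact if_neg h

theorem proj_mem (N : ℕ) (u : Fock) : proj N u ∈ finiteFock :=
  mem_finiteFock_iff.2 ⟨N, proj_proj N u⟩

/-- `P_N u` as an element of `finiteFock`. -/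
def projF (N : ℕ) (u : Fock) : finiteFock := ⟨proj N u, proj_mem N u⟩

theorem onTrunc_apply (T : Module.End ℂ finiteFock) (N : ℕ) (u : Fock) :
    onTrunc T N u = T (projF N u) := by
  have h : projF N u = ∑ i ∈ Finset.range (N + 1), u i • ketF i := by
    refine Subtype.ext ?_
    change proj N u = finiteFock.subtype (∑ i ∈ Finset.range (N + 1), u i • ketF i)
    rw [map_sum]
    simp [proj, inner_ket, ketF]
  have h2 : (T (projF N u) : Fock) = finiteFock.subtype (T (projF N u)) := rfl
  rw [h2, h, map_sum, map_sum]
  simp [onTrunc, inner_ket]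

theorem momentum_apply (u : finiteFock) (n : ℕ) :
    (momentum u : Fock) n = (1 / (Complex.I * (Real.sqrt 2 : ℂ))) *
      ((Real.sqrt (n + 1) : ℂ) * (u : Fock) (n + 1) - (Real.sqrt n : ℂ) * (u : Fock) (n - 1)) :=
  rfl

/-- A polynomial of degree one in `p` raises the Fock level by at most one; this is why the
truncation `U_{N+1}` suffices in the estimator. -/
theorem proj_succ_mul_onTrunc_affine (c d : ℂ) (N : ℕ) :
    proj (N + 1) * onTrunc (c • 1 - d • momentum) N = onTrunc (c • 1 - d • momentum) N := by
  refine ContinuousLinearMap.ext fun u => lp.ext (funext fun n => ?_)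
  change proj (N + 1) (onTrunc (c • 1 - d • momentum) N u) n = _
  rw [proj_apply]
  split_ifs with h
  · rfl
  · rw [onTrunc_apply]
    change 0 = c * proj N u n - d * (momentum (projF N u) : Fock) n
    have h1 : (projF N u : Fock) (n + 1) = 0 := by
      change proj N u (n + 1) = 0
      rw [proj_apply, if_neg (by omega)]
    have h2 : (projF N u : Fock) (n - 1) = 0 := by
      change proj N u (n - 1) = 0
      rw [proj_apply, if_neg (by omega)]
    rw [momentum_apply, h1, h2, proj_apply, if_neg (by omega)]
    simp

theorem polyQ_eq (𝒜 ε : ℝ) :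
    polyQ 𝒜 ε = (𝒜 : ℂ) • 1 - ((𝒜 : ℂ) * (ε : ℂ)) • momentum := by
  rw [polyQ, smul_sub, smul_smul]

theorem proj_succ_mul_onTrunc_polyQ (𝒜 ε : ℝ) (N : ℕ) :
    proj (N + 1) * onTrunc (polyQ 𝒜 ε) N = onTrunc (polyQ 𝒜 ε) N := by
  rw [polyQ_eq, proj_succ_mul_onTrunc_affine]

theorem proj_succ_mul_onTrunc_polyS (η ε : ℝ) (N : ℕ) :
    proj (N + 1) * onTrunc (polyS η ε) N = onTrunc (polyS η ε) N := by
  rw [polyS, proj_succ_mul_onTrunc_affine]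

/-! ### Canonical commutation relations -/

theorem inner_momentum (u v : finiteFock) :
    inner ℂ (momentum u : Fock) (v : Fock) = inner ℂ (u : Fock) (momentum v : Fock) := by
  have h2 : inner ℂ (creation u : Fock) (v : Fock) =
      inner ℂ (u : Fock) (annihilation v : Fock) := by
    rw [← inner_conj_symm, ← inner_annihilation, inner_conj_symm]
  change inner ℂ ((1 / (Complex.I * (Real.sqrt 2 : ℂ))) • ((annihilation u : Fock) -
      (creation u : Fock))) (v : Fock) = inner ℂ (u : Fock)
      ((1 / (Complex.I * (Real.sqrt 2 : ℂ))) • ((annihilation v : Fock) - (creation v : Fock)))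
  rw [inner_smul_left, inner_smul_right, inner_sub_left, inner_sub_right, inner_annihilation, h2]
  simp
  ring

theorem annihilation_mul_creation :
    annihilation * creation = creation * annihilation + 1 := by
  refine LinearMap.ext fun u => finiteFock_ext fun n => ?_
  change (Real.sqrt (n + 1) : ℂ) * ((Real.sqrt ((n + 1 : ℕ) : ℝ) : ℂ) * (u : Fock) n) =
    (Real.sqrt n : ℂ) * ((Real.sqrt ((n - 1 : ℕ) + 1) : ℂ) * (u : Fock) (n - 1 + 1)) + (u : Fock) n
  have hs : ∀ x : ℝ, 0 ≤ x → (Real.sqrt x : ℂ) * (Real.sqrt x : ℂ) = (x : ℂ) := fun x hx => by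
    rw [← Complex.ofReal_mul, Real.mul_self_sqrt hx]
  rw [← mul_assoc, ← mul_assoc]
  -- At `n = 0` the subtraction `n - 1` is truncated, and the factor `√0` removes the spurious term.
  rcases n with _ | n
  · simp
  · have h1 := hs ((n + 1 : ℕ) + 1 : ℝ) (by positivity)
    have h2 := hs (n + 1 : ℝ) (by positivity)
    simp only [Nat.add_sub_cancel]
    push_cast at h1 h2 ⊢
    rw [h1, h2]
    ring

theorem momentum_mul_position :
    momentum * position = position * momentum - Complex.I • (1 : Module.End ℂ finiteFock) := by
  have h2 : (1 / (Complex.I * (Real.sqrt 2 : ℂ))) * (1 / (Real.sqrt 2 : ℂ)) =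
      -(Complex.I / 2) := by
    have hs : (Real.sqrt 2 : ℂ) * (Real.sqrt 2 : ℂ) = 2 := by
      rw [← Complex.ofReal_mul, Real.mul_self_sqrt (by norm_num)]
      norm_num
    rw [div_mul_div_comm, mul_one, mul_assoc, hs, one_div, mul_inv, Complex.inv_I]
    ring
  -- This is `[a - a†, a + a†] = 2 [a, a†]`, with the prefactor `-i/2` from `h2`.
  have h : momentum * position - position * momentum =
      -(Complex.I / 2) • ((annihilation * creation - creation * annihilation) +
        (annihilation * creation - creation * annihilation)) := by
    rw [momentum, position, smul_mul_smul_comm, smul_mul_smul_comm, h2,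
      mul_comm (1 / (Real.sqrt 2 : ℂ)), h2]
    simp only [sub_mul, mul_sub, add_mul, mul_add]
    module
  rw [annihilation_mul_creation, add_sub_cancel_left] at h
  rw [sub_eq_iff_eq_add'.1 h]
  module

theorem momentum_mul_position_pow (j : ℕ) :
    momentum * position ^ (j + 1) =
      position ^ (j + 1) * momentum - ((j + 1 : ℂ) * Complex.I) • position ^ j := by
  induction j with
  | zero => simpa using momentum_mul_position
  | succ j ih =>
    rw [pow_succ, ← mul_assoc, ih, sub_mul, mul_assoc, momentum_mul_position, mul_sub,
      ← mul_assoc, smul_mul_assoc, mul_smul_comm, mul_one, ← pow_succ, ← pow_succ]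
    push_cast
    module

/-- The commutator `[p, q^(j+1)] = -i (j+1) q^j` lowers the degree by one, and `(iη)^(j+1)/(j+1)! ·
(-i (j+1)) = η (iη)^j/j!`. -/
theorem expTerm_succ_momentum (η : ℝ) (w : finiteFock) (u : finiteFock) (j : ℕ) :
    inner ℂ (momentum u : Fock) (expTerm η w (j + 1)) =
      inner ℂ (u : Fock) (expTerm η (momentum w) (j + 1)) +
        (η : ℂ) * inner ℂ (u : Fock) (expTerm η w j) := by
  rw [expTerm, expTerm, expTerm, inner_smul_right, inner_smul_right, inner_smul_right,
    inner_momentum, ← Module.End.mul_apply, momentum_mul_position_pow]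
  change _ * inner ℂ (u : Fock) ((((position ^ (j + 1)) (momentum w) : finiteFock) : Fock) -
    ((j + 1 : ℂ) * Complex.I) • (((position ^ j) w : finiteFock) : Fock)) = _
  rw [inner_sub_right, inner_smul_right, mul_sub, sub_eq_add_neg]
  congr 1
  have h1 : ((j : ℂ) + 1) ≠ 0 := by exact_mod_cast j.succ_ne_zero
  have h2 : (j.factorial : ℂ) ≠ 0 := by exact_mod_cast j.factorial_ne_zero
  rw [Nat.factorial_succ, pow_succ]
  push_cast
  field_simp
  rw [Complex.I_sq]
  ring

theorem hasSum_inner_expTerm (η : ℝ) (x : Fock) (w : finiteFock) :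
    HasSum (fun j => inner ℂ x (expTerm η w j))
      (inner ℂ x ((expPosition η : Fock →L[ℂ] Fock) (w : Fock))) :=
  (innerSL ℂ x).hasSum (expPosition_hasSum η w)

/-- The relation `p U = U (p + η)`, stated weakly since `U w` need not be a finite vector, and
obtained by summing the exponential series term by term. -/
theorem inner_momentum_expPosition (η : ℝ) (u w : finiteFock) :
    inner ℂ (momentum u : Fock) ((expPosition η : Fock →L[ℂ] Fock) (w : Fock)) =
      inner ℂ (u : Fock) ((expPosition η : Fock →L[ℂ] Fock) (momentum w : Fock)) +
        (η : ℂ) * inner ℂ (u : Fock) ((expPosition η : Fock →L[ℂ] Fock) (w : Fock)) := by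
  have h1 := hasSum_inner_expTerm η (momentum u : Fock) w
  have h2 := hasSum_inner_expTerm η (u : Fock) (momentum w)
  have h3 := (hasSum_inner_expTerm η (u : Fock) w).mul_left (η : ℂ)
  -- Dropping the term of degree `0` from the two series with `p` aligns them with the unshifted
  -- third one; the dropped terms agree by symmetry of `p`.
  rw [← hasSum_nat_add_iff' 1] at h1 h2
  simp only [expTerm_succ_momentum, Finset.sum_range_one] at h1 h2
  have h := h1.unique (h2.add h3)
  have h0 : inner ℂ (momentum u : Fock) (expTerm η w 0) =
      inner ℂ (u : Fock) (expTerm η (momentum w) 0) := by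
    simpa [expTerm] using inner_momentum u w
  rw [h0, sub_eq_iff_eq_add] at h
  rw [h]
  ring

/-- `⟨𝒜 S u, U w⟩ = ⟨u, U Q w⟩`, the weak form of `Q U† = U† (U Q U†)`. -/
theorem inner_polyS_expPosition (𝒜 η ε : ℝ) (u w : finiteFock) :
    (𝒜 : ℂ) * inner ℂ (polyS η ε u : Fock) ((expPosition η : Fock →L[ℂ] Fock) (w : Fock)) =
      inner ℂ (u : Fock) ((expPosition η : Fock →L[ℂ] Fock) (polyQ 𝒜 ε w : Fock)) := by
  have hS : (polyS η ε u : Fock) =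
      (1 + (ε : ℂ) * (η : ℂ)) • (u : Fock) - (ε : ℂ) • (momentum u : Fock) := rfl
  have hQ : (polyQ 𝒜 ε w : Fock) = (𝒜 : ℂ) • ((w : Fock) - (ε : ℂ) • (momentum w : Fock)) := rfl
  rw [hS, hQ, map_smul, map_sub, map_smul, inner_sub_left, inner_smul_left, inner_smul_left,
    inner_momentum_expPosition, inner_smul_right, inner_sub_right, inner_smul_right]
  simp only [map_add, map_one, map_mul, Complex.conj_ofReal]
  ring

theorem inner_polyQ (𝒜 ε : ℝ) (u w : finiteFock) :
    inner ℂ (polyQ 𝒜 ε u : Fock) (w : Fock) = inner ℂ (u : Fock) (polyQ 𝒜 ε w : Fock) := by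
  have hQ : ∀ w, (polyQ 𝒜 ε w : Fock) =
      (𝒜 : ℂ) • ((w : Fock) - (ε : ℂ) • (momentum w : Fock)) := fun _ => rfl
  rw [hQ, hQ, inner_smul_left, inner_smul_right, inner_sub_left, inner_sub_right,
    inner_smul_left, inner_smul_right, inner_momentum]
  simp only [Complex.conj_ofReal]

/-! ### The rotation -/

theorem rotation_apply (u : Fock) (n : ℕ) : (rotation : Fock →L[ℂ] Fock) u n =
    Complex.exp (Complex.I * (Real.pi / 2 : ℝ) * n) * u n := rfl

theorem commute_rotation_proj (N : ℕ) : Commute (rotation : Fock →L[ℂ] Fock) (proj N) := by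
  refine ContinuousLinearMap.ext fun u => lp.ext (funext fun n => ?_)
  change (rotation : Fock →L[ℂ] Fock) (proj N u) n = proj N ((rotation : Fock →L[ℂ] Fock) u) n
  rw [rotation_apply, proj_apply, proj_apply, rotation_apply]
  split_ifs <;> simp

theorem commute_rotation_pow_proj (k N : ℕ) :
    Commute ((rotation ^ k : unitary (Fock →L[ℂ] Fock)) : Fock →L[ℂ] Fock) (proj N) := by
  rw [SubmonoidClass.coe_pow]
  exact (commute_rotation_proj N).pow_left k

theorem coe_rotation_inv_pow (k : ℕ) :
    ((rotation⁻¹ ^ k : unitary (Fock →L[ℂ] Fock)) : Fock →L[ℂ] Fock) =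
      star ((rotation ^ k : unitary (Fock →L[ℂ] Fock)) : Fock →L[ℂ] Fock) := by
  rw [inv_pow]
  rfl

/-! ### Graphs of unbounded operators -/

/-- A pair in a graph carries both membership in the domain and the value, so natural domains of
sums and products can be handled by composing pairs. -/
theorem mem_graph_comp {S T : Fock →ₗ.[ℂ] Fock} {x y z : Fock} (hT : (x, y) ∈ T.graph)
    (hS : (y, z) ∈ S.graph) : (x, z) ∈ (comp S T).graph := by
  obtain ⟨x, rfl, rfl⟩ := LinearPMap.mem_graph_iff _ |>.1 hT
  obtain ⟨y', hy', rfl⟩ := LinearPMap.mem_graph_iff _ |>.1 hS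
  have hy : T x ∈ S.domain := by
    have h : (y' : Fock) = T x := hy'
    exact h ▸ y'.2
  refine LinearPMap.mem_graph_iff _ |>.2 ⟨⟨x, ⟨x, hy, rfl⟩⟩, rfl, ?_⟩
  change S ⟨T x, hy⟩ = S y'
  congr 1
  exact Subtype.ext hy'.symm

theorem exists_mem_graph_of_mem_graph_comp {S T : Fock →ₗ.[ℂ] Fock} {x z : Fock}
    (h : (x, z) ∈ (comp S T).graph) : ∃ y, (x, y) ∈ T.graph ∧ (y, z) ∈ S.graph := by
  obtain ⟨⟨_, x, hx, rfl⟩, rfl, rfl⟩ := LinearPMap.mem_graph_iff _ |>.1 h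
  exact ⟨T x, T.mem_graph x, S.mem_graph ⟨T x, hx⟩⟩

theorem mem_domain_of_mem_domain_comp {S T : Fock →ₗ.[ℂ] Fock} {x : Fock}
    (h : x ∈ (comp S T).domain) : x ∈ T.domain := by
  obtain ⟨x, -, rfl⟩ := h
  exact x.2

theorem mem_graph_add {S T : Fock →ₗ.[ℂ] Fock} {x y z : Fock} (hS : (x, y) ∈ S.graph)
    (hT : (x, z) ∈ T.graph) : (x, y + z) ∈ (S + T).graph := by
  obtain ⟨x, rfl, rfl⟩ := LinearPMap.mem_graph_iff _ |>.1 hS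
  obtain ⟨x', hx', rfl⟩ := LinearPMap.mem_graph_iff _ |>.1 hT
  exact LinearPMap.mem_graph_iff _ |>.2 ⟨⟨x, x.2, by
    have h : (x' : Fock) = x := hx'
    exact h ▸ x'.2⟩, rfl, congrArg (S x + ·) (congrArg T (Subtype.ext hx'.symm))⟩

theorem mem_graph_sub {S T : Fock →ₗ.[ℂ] Fock} {x y z : Fock} (hS : (x, y) ∈ S.graph)
    (hT : (x, z) ∈ T.graph) : (x, y - z) ∈ (S - T).graph := by
  obtain ⟨x, rfl, rfl⟩ := LinearPMap.mem_graph_iff _ |>.1 hS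
  obtain ⟨x', hx', rfl⟩ := LinearPMap.mem_graph_iff _ |>.1 hT
  exact LinearPMap.mem_graph_iff _ |>.2 ⟨⟨x, x.2, by
    have h : (x' : Fock) = x := hx'
    exact h ▸ x'.2⟩, rfl, congrArg (S x - ·) (congrArg T (Subtype.ext hx'.symm))⟩

theorem mem_graph_smul {S : Fock →ₗ.[ℂ] Fock} {x y : Fock} (c : ℂ) (hS : (x, y) ∈ S.graph) :
    (x, c • y) ∈ (c • S).graph := by
  obtain ⟨x, rfl, rfl⟩ := LinearPMap.mem_graph_iff _ |>.1 hS
  exact LinearPMap.mem_graph_iff _ |>.2 ⟨x, rfl, rfl⟩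

theorem mem_graph_sum {ι : Type*} (s : Finset ι) {T : ι → Fock →ₗ.[ℂ] Fock} {x : Fock}
    {y : ι → Fock} (h : ∀ i ∈ s, (x, y i) ∈ (T i).graph) :
    (x, ∑ i ∈ s, y i) ∈ (∑ i ∈ s, T i).graph := by
  classical
  induction s using Finset.induction_on with
  | empty => exact LinearPMap.mem_graph_iff _ |>.2 ⟨⟨x, trivial⟩, rfl, rfl⟩
  | insert i s hi ih =>
    rw [Finset.sum_insert hi, Finset.sum_insert hi]
    exact mem_graph_add (h i (by simp)) (ih fun j hj => h j (by simp [hj]))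

theorem domain_sum_le {ι : Type*} {s : Finset ι} (T : ι → Fock →ₗ.[ℂ] Fock) {i : ι}
    (hi : i ∈ s) : (∑ i ∈ s, T i).domain ≤ (T i).domain := by
  classical
  rw [← Finset.add_sum_erase s T hi]
  exact inf_le_left

theorem mem_graph_ofBounded (A : Fock →L[ℂ] Fock) (x : Fock) : (x, A x) ∈ (ofBounded A).graph :=
  LinearPMap.mem_graph_iff _ |>.2 ⟨⟨x, trivial⟩, rfl, rfl⟩

theorem eq_of_mem_graph_ofBounded {A : Fock →L[ℂ] Fock} {x y : Fock}
    (h : (x, y) ∈ (ofBounded A).graph) : y = A x := by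
  obtain ⟨x, rfl, rfl⟩ := LinearPMap.mem_graph_iff _ |>.1 h
  rfl

theorem eq_ofBounded_of_mem_graph {T : Fock →ₗ.[ℂ] Fock} {A : Fock →L[ℂ] Fock}
    (h : ∀ x, (x, A x) ∈ T.graph) : T = ofBounded A := by
  refine (LinearPMap.eq_of_le_of_domain_eq (LinearPMap.le_of_le_graph ?_) ?_).symm
  · rintro ⟨x, y⟩ hxy
    rw [eq_of_mem_graph_ofBounded hxy]
    exact h x
  · exact (eq_top_iff.2 fun x _ => LinearPMap.mem_domain_of_mem_graph (h x)).symm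

theorem inner_eq_of_mem_graph_adjoint {T : Fock →ₗ.[ℂ] Fock} (hT : Dense (T.domain : Set Fock))
    {x w u g : Fock} (h : (x, w) ∈ T.adjoint.graph) (hu : (u, g) ∈ T.graph) :
    inner ℂ w u = inner ℂ x g := by
  obtain ⟨x, rfl, rfl⟩ := LinearPMap.mem_graph_iff _ |>.1 h
  obtain ⟨u, rfl, rfl⟩ := LinearPMap.mem_graph_iff _ |>.1 hu
  exact LinearPMap.adjoint_isFormalAdjoint hT x u

theorem mem_graph_adjoint {T : Fock →ₗ.[ℂ] Fock} (hT : Dense (T.domain : Set Fock))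
    {x w : Fock} (h : ∀ u g, (u, g) ∈ T.graph → inner ℂ w u = inner ℂ x g) :
    (x, w) ∈ T.adjoint.graph := by
  have hw : ∀ u : T.domain, inner ℂ w (u : Fock) = inner ℂ x (T u) := fun u =>
    h u (T u) (T.mem_graph u)
  exact LinearPMap.mem_graph_iff _ |>.2
    ⟨⟨x, LinearPMap.mem_adjoint_domain_of_exists x ⟨w, hw⟩⟩, rfl,
      LinearPMap.adjoint_apply_eq hT _ hw⟩

theorem mem_graph_adjoint_ofBounded (A : Fock →L[ℂ] Fock) (x : Fock) :
    (x, star A x) ∈ (ofBounded A).adjoint.graph := by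
  refine mem_graph_adjoint dense_univ fun u g hug => ?_
  rw [eq_of_mem_graph_ofBounded hug, inner_star_left]

/-- The two hypotheses force the domain to be exactly the dense core. -/
theorem isBoundedExtension_of_mem_graph {T : Fock →ₗ.[ℂ] Fock} {X : Fock →L[ℂ] Fock}
    (hdom : T.domain ≤ finiteFock) (h : ∀ u ∈ finiteFock, (u, X u) ∈ T.graph) :
    IsBoundedExtension T X := by
  refine ⟨dense_finiteFock.mono fun u hu => LinearPMap.mem_domain_of_mem_graph (h u hu),
    fun x => ?_⟩
  obtain ⟨y, hy, hy'⟩ := LinearPMap.mem_graph_iff _ |>.1 (h x (hdom x.2))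
  exact hy'.symm.trans (congrArg T (Subtype.ext hy))

/-! ### Dissipators on truncated states -/

/-- `G ρ G† - ½ (K ρ + ρ K†)` for bounded operators; it is the dissipator of `G` for
`K = G† G`. -/
def boundedDissipator {H : Type*} [NormedAddCommGroup H] [InnerProductSpace ℂ H]
    [CompleteSpace H] (G K ρ : H →L[ℂ] H) : H →L[ℂ] H :=
  G * ρ * star G - (1 / 2 : ℂ) • (K * ρ + ρ * star K)

/-- The dissipator of `Γ` at a state `ρ = P_N ρ P_N` acts through `G = Γ P_N` and
`K = Γ† Γ P_N`. -/
theorem mem_graph_dissipator {Γ : Fock →ₗ.[ℂ] Fock} {G K ρ : Fock →L[ℂ] Fock} {N : ℕ}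
    (hd : Dense (Γ.domain : Set Fock)) (hl : proj N * ρ = ρ) (hr : ρ * proj N = ρ)
    (hG : ∀ u, (proj N u, G u) ∈ Γ.graph) (hK : ∀ u, (G u, K u) ∈ Γ.adjoint.graph)
    {x w y z : Fock} (hxw : (x, w) ∈ Γ.adjoint.graph) (hxy : (x, y) ∈ Γ.graph)
    (hyz : (y, z) ∈ Γ.adjoint.graph) :
    (x, boundedDissipator G K ρ x) ∈ (dissipator Γ ρ).graph := by
  have hl' : ∀ u, proj N (ρ u) = ρ u := fun u => DFunLike.congr_fun hl u
  have hr' : ∀ u, ρ (proj N u) = ρ u := fun u => DFunLike.congr_fun hr u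
  have hG' : ∀ u, (ρ u, G (ρ u)) ∈ Γ.graph := fun u => by
    have := hG (ρ u)
    rwa [hl'] at this
  -- As `G = Γ P_N`, its adjoint is `P_N Γ†` at `x`; the projector is then absorbed by `ρ P_N = ρ`.
  -- The same holds for `K†` below, where `Γ` is moved back and forth across the inner product.
  have hw : star G x = proj N w := by
    refine ext_inner_right ℂ fun v => ?_
    rw [inner_star_left, inner_proj_left, inner_eq_of_mem_graph_adjoint hd hxw (hG v)]
  have hz : star K x = proj N z := by
    refine ext_inner_right ℂ fun v => ?_
    rw [inner_star_left, inner_proj_left, inner_eq_of_mem_graph_adjoint hd hyz (hG v),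
      ← inner_conj_symm, ← inner_conj_symm y, inner_eq_of_mem_graph_adjoint hd (hK v) hxy]
  have e1 : ρ (star G x) = ρ w := by rw [hw, hr']
  have e2 : ρ (star K x) = ρ z := by rw [hz, hr']
  have e : boundedDissipator G K ρ x =
      G (ρ (star G x)) - (1 / 2 : ℂ) • (K (ρ x) + ρ (star K x)) := rfl
  rw [e, e1, e2]
  refine mem_graph_sub ?_ (mem_graph_smul _ (mem_graph_add ?_ ?_))
  · exact mem_graph_comp (mem_graph_comp hxw (mem_graph_ofBounded ρ w)) (hG' w)
  · exact mem_graph_comp (mem_graph_comp (mem_graph_ofBounded ρ x) (hG' x)) (hK (ρ x))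
  · exact mem_graph_comp (mem_graph_comp hxy hyz) (mem_graph_ofBounded ρ z)

theorem mem_graph_dissipator_ofBounded (A ρ : Fock →L[ℂ] Fock) (x : Fock) :
    (x, boundedDissipator A (star A * A) ρ x) ∈ (dissipator (ofBounded A) ρ).graph := by
  have e : boundedDissipator A (star A * A) ρ x =
      A (ρ (star A x)) - (1 / 2 : ℂ) • (star A (A (ρ x)) + ρ (star A (A x))) := by
    have hs : star (star A * A) = star A * A := star_eq_of_nonneg (star_mul_self_nonneg' A)
    rw [boundedDissipator, hs]
    rfl
  rw [e]
  have hA := mem_graph_ofBounded A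
  have hA' := mem_graph_adjoint_ofBounded A
  have hρ := mem_graph_ofBounded ρ
  exact mem_graph_sub (mem_graph_comp (mem_graph_comp (hA' _) (hρ _)) (hA _))
    (mem_graph_smul _ (mem_graph_add (mem_graph_comp (mem_graph_comp (hρ _) (hA _)) (hA' _))
      (mem_graph_comp (mem_graph_comp (hA _) (hA' _)) (hρ _))))

/-! ### The jump operators -/

/-- `Γ₀ P_N` as a bounded operator. -/
def jumpTrunc (𝒜 η ε : ℝ) (N : ℕ) : Fock →L[ℂ] Fock :=
  (expPosition η : Fock →L[ℂ] Fock) * onTrunc (polyQ 𝒜 ε) N - proj N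

/-- `Γ₀† Γ₀ P_N` as a bounded operator. -/
def jumpSqTrunc (𝒜 η ε : ℝ) (N : ℕ) : Fock →L[ℂ] Fock :=
  onTrunc (polyQ 𝒜 ε * polyQ 𝒜 ε) N - (expPosition η : Fock →L[ℂ] Fock) * onTrunc (polyQ 𝒜 ε) N -
    (𝒜 : ℂ) • (star (expPosition η : Fock →L[ℂ] Fock) * onTrunc (polyS η ε) N) + proj N

/-- `Γ₀` on `finiteFock`. -/
def jumpZeroApply (𝒜 η ε : ℝ) (u : finiteFock) : Fock :=
  (expPosition η : Fock →L[ℂ] Fock) (polyQ 𝒜 ε u : Fock) - (u : Fock)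

/-- `Γ₀†` on `finiteFock`. -/
def jumpZeroAdjoint (𝒜 η ε : ℝ) (u : finiteFock) : Fock :=
  (𝒜 : ℂ) • star (expPosition η : Fock →L[ℂ] Fock) (polyS η ε u : Fock) - (u : Fock)

theorem jumpTrunc_apply (𝒜 η ε : ℝ) (N : ℕ) (u : Fock) :
    jumpTrunc 𝒜 η ε N u = jumpZeroApply 𝒜 η ε (projF N u) := by
  change (expPosition η : Fock →L[ℂ] Fock) (onTrunc (polyQ 𝒜 ε) N u) - proj N u = _
  rw [onTrunc_apply]
  rfl

theorem inner_jumpZeroAdjoint (𝒜 η ε : ℝ) (u w : finiteFock) :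
    inner ℂ (jumpZeroAdjoint 𝒜 η ε u) (w : Fock) =
      inner ℂ (u : Fock) (jumpZeroApply 𝒜 η ε w) := by
  rw [jumpZeroApply, jumpZeroAdjoint, inner_sub_left, inner_sub_right, inner_smul_left, Complex.conj_ofReal,
    inner_star_left, inner_polyS_expPosition]

theorem inner_unitary (V : unitary (Fock →L[ℂ] Fock)) (x y : Fock) :
    inner ℂ ((V : Fock →L[ℂ] Fock) x) ((V : Fock →L[ℂ] Fock) y) = inner ℂ x y := by
  rw [← inner_star_right]
  have h : star (V : Fock →L[ℂ] Fock) ((V : Fock →L[ℂ] Fock) y) = y :=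
    DFunLike.congr_fun (Unitary.coe_star_mul_self V) y
  rw [h]

/-- This is `(Q U† - 1)(U Q - 1)` tested against a finite vector: unitarity and symmetry of `Q` give
the `Q²` term, and `inner_jumpZeroAdjoint` handles the term coming from `-P_N`. -/
theorem inner_jumpSqTrunc (𝒜 η ε : ℝ) (N : ℕ) (u : Fock) (w : finiteFock) :
    inner ℂ (jumpSqTrunc 𝒜 η ε N u) (w : Fock) =
      inner ℂ (jumpTrunc 𝒜 η ε N u) (jumpZeroApply 𝒜 η ε w) := by
  have hK : jumpSqTrunc 𝒜 η ε N u = (polyQ 𝒜 ε (polyQ 𝒜 ε (projF N u)) : Fock) -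
      (expPosition η : Fock →L[ℂ] Fock) (polyQ 𝒜 ε (projF N u) : Fock) -
      jumpZeroAdjoint 𝒜 η ε (projF N u) := by
    have e : jumpSqTrunc 𝒜 η ε N u = onTrunc (polyQ 𝒜 ε * polyQ 𝒜 ε) N u -
      (expPosition η : Fock →L[ℂ] Fock) (onTrunc (polyQ 𝒜 ε) N u) -
      (𝒜 : ℂ) • (star (expPosition η : Fock →L[ℂ] Fock) (onTrunc (polyS η ε) N u)) +
      proj N u := rfl
    rw [e, onTrunc_apply, onTrunc_apply, onTrunc_apply, jumpZeroAdjoint, Module.End.mul_apply]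
    change _ = _ - _ - (_ - proj N u)
    abel
  rw [hK, inner_sub_left, inner_jumpZeroAdjoint, jumpTrunc_apply, jumpZeroApply, jumpZeroApply,
    inner_sub_left, inner_sub_left, inner_sub_right, inner_sub_right, inner_unitary, inner_polyQ]

theorem mem_graph_jump_iff (𝒜 η ε : ℝ) (k : ℕ) {x y : Fock} :
    (x, y) ∈ (jump 𝒜 η ε k).graph ↔ ∃ u : finiteFock,
      x = ((rotation ^ k : unitary (Fock →L[ℂ] Fock)) : Fock →L[ℂ] Fock) u ∧
      y = ((rotation ^ k : unitary (Fock →L[ℂ] Fock)) : Fock →L[ℂ] Fock)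
        (jumpZeroApply 𝒜 η ε u) := by
  rw [jump, coe_rotation_inv_pow]
  set V : unitary (Fock →L[ℂ] Fock) := rotation ^ k
  constructor
  · intro h
    obtain ⟨y', h, h3⟩ := exists_mem_graph_of_mem_graph_comp h
    obtain ⟨x', h1, h2⟩ := exists_mem_graph_of_mem_graph_comp h
    obtain ⟨u, hu, rfl⟩ := LinearPMap.mem_graph_iff _ |>.1 h2
    refine ⟨u, ?_, eq_of_mem_graph_ofBounded h3⟩
    have hx : (u : Fock) = star (V : Fock →L[ℂ] Fock) x :=
      Eq.trans hu (eq_of_mem_graph_ofBounded h1)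
    rw [hx]
    exact (DFunLike.congr_fun (Unitary.coe_mul_star_self V) x).symm
  · rintro ⟨u, rfl, rfl⟩
    refine mem_graph_comp (mem_graph_comp (mem_graph_ofBounded _ _) ?_) (mem_graph_ofBounded _ _)
    have h : star (V : Fock →L[ℂ] Fock) ((V : Fock →L[ℂ] Fock) u) = u :=
      DFunLike.congr_fun (Unitary.coe_star_mul_self V) (u : Fock)
    rw [h]
    exact (jumpZero 𝒜 η ε).mem_graph u

theorem rotation_pow_mem_finiteFock (k : ℕ) {u : Fock} (hu : u ∈ finiteFock) :
    ((rotation ^ k : unitary (Fock →L[ℂ] Fock)) : Fock →L[ℂ] Fock) u ∈ finiteFock := by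
  obtain ⟨N, hN⟩ := mem_finiteFock_iff.1 hu
  refine mem_finiteFock_iff.2 ⟨N, ?_⟩
  conv_rhs => rw [← hN]
  exact (DFunLike.congr_fun (commute_rotation_pow_proj k N).eq u).symm

theorem star_commute_proj {V : Fock →L[ℂ] Fock} {N : ℕ} (h : Commute V (proj N)) :
    Commute (star V) (proj N) := by
  have h2 : star (V * proj N) = star (proj N * V) := by rw [h.eq]
  rw [star_mul_eq, star_mul_eq, star_proj] at h2
  exact h2.symm

theorem exists_rotation_pow_eq (k : ℕ) {x : Fock} (hx : x ∈ finiteFock) :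
    ∃ u : finiteFock, x = ((rotation ^ k : unitary (Fock →L[ℂ] Fock)) : Fock →L[ℂ] Fock) u := by
  obtain ⟨N, hN⟩ := mem_finiteFock_iff.1 hx
  set V : unitary (Fock →L[ℂ] Fock) := rotation ^ k
  refine ⟨⟨star (V : Fock →L[ℂ] Fock) x, mem_finiteFock_iff.2 ⟨N, ?_⟩⟩,
    (DFunLike.congr_fun (Unitary.coe_mul_star_self V) x).symm⟩
  conv_rhs => rw [← hN]
  exact (DFunLike.congr_fun (star_commute_proj (commute_rotation_pow_proj k N)).eq x).symm

/-- Powers of `R` commute with all `P_N`, hence permute the core, and the four jump operators share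
one domain. -/
theorem domain_jump (𝒜 η ε : ℝ) (k : ℕ) : (jump 𝒜 η ε k).domain = finiteFock := by
  ext x
  rw [LinearPMap.mem_domain_iff]
  constructor
  · rintro ⟨y, h⟩
    obtain ⟨u, rfl, -⟩ := (mem_graph_jump_iff 𝒜 η ε k).1 h
    exact rotation_pow_mem_finiteFock k u.2
  · intro hx
    obtain ⟨u, rfl⟩ := exists_rotation_pow_eq k hx
    exact ⟨_, (mem_graph_jump_iff 𝒜 η ε k).2 ⟨u, rfl, rfl⟩⟩

theorem dense_domain_jump (𝒜 η ε : ℝ) (k : ℕ) :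
    Dense ((jump 𝒜 η ε k).domain : Set Fock) := by
  rw [domain_jump]
  exact dense_finiteFock

theorem mem_graph_jump_adjoint (𝒜 η ε : ℝ) (k : ℕ) (u : finiteFock) :
    (((rotation ^ k : unitary (Fock →L[ℂ] Fock)) : Fock →L[ℂ] Fock) u,
      ((rotation ^ k : unitary (Fock →L[ℂ] Fock)) : Fock →L[ℂ] Fock)
        (jumpZeroAdjoint 𝒜 η ε u)) ∈ (jump 𝒜 η ε k).adjoint.graph := by
  refine mem_graph_adjoint (dense_domain_jump 𝒜 η ε k) fun x y hxy => ?_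
  obtain ⟨w, rfl, rfl⟩ := (mem_graph_jump_iff 𝒜 η ε k).1 hxy
  rw [inner_unitary, inner_unitary, inner_jumpZeroAdjoint]

/-- `Γ_k` need not map the core into itself, but its image lies in the domain of the adjoint; this
makes `Γ_k† Γ_k` defined on the core. -/
theorem mem_graph_jump_adjoint_jumpTrunc (𝒜 η ε : ℝ) (k N : ℕ) (u : Fock) :
    (((rotation ^ k : unitary (Fock →L[ℂ] Fock)) : Fock →L[ℂ] Fock) (jumpTrunc 𝒜 η ε N u),
      ((rotation ^ k : unitary (Fock →L[ℂ] Fock)) : Fock →L[ℂ] Fock)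
        (jumpSqTrunc 𝒜 η ε N u)) ∈ (jump 𝒜 η ε k).adjoint.graph := by
  refine mem_graph_adjoint (dense_domain_jump 𝒜 η ε k) fun x y hxy => ?_
  obtain ⟨w, rfl, rfl⟩ := (mem_graph_jump_iff 𝒜 η ε k).1 hxy
  rw [inner_unitary, inner_unitary, inner_jumpSqTrunc]

/-- Conjugation `A ↦ R^k A R^{-k}`. -/
def conjRotation (k : ℕ) (A : Fock →L[ℂ] Fock) : Fock →L[ℂ] Fock :=
  ((rotation ^ k : unitary (Fock →L[ℂ] Fock)) : Fock →L[ℂ] Fock) * A *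
    star ((rotation ^ k : unitary (Fock →L[ℂ] Fock)) : Fock →L[ℂ] Fock)

theorem mem_graph_jump_conjRotation (𝒜 η ε : ℝ) (k N : ℕ) (x : Fock) :
    (proj N x, conjRotation k (jumpTrunc 𝒜 η ε N) x) ∈ (jump 𝒜 η ε k).graph := by
  refine (mem_graph_jump_iff 𝒜 η ε k).2 ⟨projF N
    (star ((rotation ^ k : unitary (Fock →L[ℂ] Fock)) : Fock →L[ℂ] Fock) x), ?_, ?_⟩
  · set V : unitary (Fock →L[ℂ] Fock) := rotation ^ k
    have h1 : proj N (star (V : Fock →L[ℂ] Fock) x) = star (V : Fock →L[ℂ] Fock) (proj N x) :=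
      (DFunLike.congr_fun (star_commute_proj (commute_rotation_pow_proj k N)).eq x).symm
    change _ = (V : Fock →L[ℂ] Fock) (proj N (star (V : Fock →L[ℂ] Fock) x))
    rw [h1]
    exact (DFunLike.congr_fun (Unitary.coe_mul_star_self V) (proj N x)).symm
  · rw [← jumpTrunc_apply]
    rfl

theorem mem_graph_dissipator_jump (𝒜 η ε : ℝ) (k : ℕ) {N : ℕ} {ρ : Fock →L[ℂ] Fock}
    (hl : proj N * ρ = ρ) (hr : ρ * proj N = ρ) {x : Fock} (hx : x ∈ finiteFock) :
    (x, boundedDissipator (conjRotation k (jumpTrunc 𝒜 η ε N))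
      (conjRotation k (jumpSqTrunc 𝒜 η ε N)) ρ x) ∈ (dissipator (jump 𝒜 η ε k) ρ).graph := by
  -- The level `M` of the test vector is unrelated to the level `N` of `ρ`; it serves to compute
  -- `Γ_k x` and `Γ_k† Γ_k x`.
  obtain ⟨M, hM⟩ := mem_finiteFock_iff.1 hx
  obtain ⟨u, hu⟩ := exists_rotation_pow_eq k hx
  have hxw := mem_graph_jump_adjoint 𝒜 η ε k u
  rw [← hu] at hxw
  have hxy := mem_graph_jump_conjRotation 𝒜 η ε k M x
  rw [hM] at hxy
  exact mem_graph_dissipator (dense_domain_jump 𝒜 η ε k) hl hr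
    (mem_graph_jump_conjRotation 𝒜 η ε k N)
    (fun v => mem_graph_jump_adjoint_jumpTrunc 𝒜 η ε k N _) hxw hxy
    (mem_graph_jump_adjoint_jumpTrunc 𝒜 η ε k M _)

theorem comp_proj_jump_proj (𝒜 η ε : ℝ) (k N : ℕ) :
    comp (ofBounded (proj N)) (comp (jump 𝒜 η ε k) (ofBounded (proj N))) =
      ofBounded (proj N * conjRotation k (jumpTrunc 𝒜 η ε N)) :=
  eq_ofBounded_of_mem_graph fun x => mem_graph_comp
    (mem_graph_comp (mem_graph_ofBounded _ x) (mem_graph_jump_conjRotation 𝒜 η ε k N x))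
    (mem_graph_ofBounded _ _)

/-- The difference of the dissipators of `G` and `P G`. -/
def truncationDefect {H : Type*} [NormedAddCommGroup H] [InnerProductSpace ℂ H]
    [CompleteSpace H] (P G K ρ : H →L[ℂ] H) : H →L[ℂ] H :=
  boundedDissipator G K ρ - boundedDissipator (P * G) (star (P * G) * (P * G)) ρ

theorem isBoundedExtension_lindbladian_sub (𝒜 η ε : ℝ) {N : ℕ} {ρ : Fock →L[ℂ] Fock}
    (hl : proj N * ρ = ρ) (hr : ρ * proj N = ρ) :
    IsBoundedExtension (lindbladian 𝒜 η ε ρ - lindbladianTrunc 𝒜 η ε N ρ)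
      (∑ k ∈ Finset.range 4, truncationDefect (proj N) (conjRotation k (jumpTrunc 𝒜 η ε N))
        (conjRotation k (jumpSqTrunc 𝒜 η ε N)) ρ) := by
  refine isBoundedExtension_of_mem_graph ?_ fun u hu => ?_
  · intro x hx
    -- The term `ρ Γ† Γ` of the `k = 0` dissipator already requires `x` to lie in the domain of the
    -- jump operator, so the domain cannot exceed the core.
    have h1 : x ∈ (dissipator (jump 𝒜 η ε 0) ρ).domain :=
      domain_sum_le (s := Finset.range 4) (fun k => dissipator (jump 𝒜 η ε k) ρ) (i := 0)
        (by simp) hx.1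
    have h2 := mem_domain_of_mem_domain_comp (mem_domain_of_mem_domain_comp h1.2.2)
    rwa [domain_jump] at h2
  · have h : (∑ k ∈ Finset.range 4, truncationDefect (proj N)
        (conjRotation k (jumpTrunc 𝒜 η ε N)) (conjRotation k (jumpSqTrunc 𝒜 η ε N)) ρ) u =
        (∑ k ∈ Finset.range 4, boundedDissipator (conjRotation k (jumpTrunc 𝒜 η ε N))
          (conjRotation k (jumpSqTrunc 𝒜 η ε N)) ρ u) -
        ∑ k ∈ Finset.range 4, boundedDissipator (proj N * conjRotation k (jumpTrunc 𝒜 η ε N))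
          (star (proj N * conjRotation k (jumpTrunc 𝒜 η ε N)) *
            (proj N * conjRotation k (jumpTrunc 𝒜 η ε N))) ρ u := by
      rw [sum_apply, ← Finset.sum_sub_distrib]
      rfl
    rw [h]
    refine mem_graph_sub (mem_graph_sum _ fun k _ => mem_graph_dissipator_jump 𝒜 η ε k hl hr hu)
      (mem_graph_sum _ fun k _ => ?_)
    rw [comp_proj_jump_proj]
    exact mem_graph_dissipator_ofBounded _ _ _

/-! ### The truncation defect -/

section Algebra

variable {H : Type*} [NormedAddCommGroup H] [InnerProductSpace ℂ H] [CompleteSpace H]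

theorem star_conj (V : unitary (H →L[ℂ] H)) (A : H →L[ℂ] H) :
    star ((V : H →L[ℂ] H) * A * star (V : H →L[ℂ] H)) =
      (V : H →L[ℂ] H) * star A * star (V : H →L[ℂ] H) := by
  rw [star_mul _ (star (V : H →L[ℂ] H)), star_mul (V : H →L[ℂ] H), star_star, mul_assoc]

theorem boundedDissipator_conj (V : unitary (H →L[ℂ] H)) (G K σ : H →L[ℂ] H) :
    boundedDissipator ((V : H →L[ℂ] H) * G * star (V : H →L[ℂ] H))
        ((V : H →L[ℂ] H) * K * star (V : H →L[ℂ] H))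
        ((V : H →L[ℂ] H) * σ * star (V : H →L[ℂ] H)) =
      (V : H →L[ℂ] H) * boundedDissipator G K σ * star (V : H →L[ℂ] H) := by
  have h := Unitary.conjStarAlgAut_apply (S := ℂ) V
  simp only [boundedDissipator, star_conj]
  simp only [← h, map_sub, map_add, map_mul, map_smul]

theorem truncationDefect_conj (V : unitary (H →L[ℂ] H)) {P : H →L[ℂ] H}
    (hV : Commute (V : H →L[ℂ] H) P) (G K σ : H →L[ℂ] H) :
    truncationDefect P ((V : H →L[ℂ] H) * G * star (V : H →L[ℂ] H))
        ((V : H →L[ℂ] H) * K * star (V : H →L[ℂ] H))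
        ((V : H →L[ℂ] H) * σ * star (V : H →L[ℂ] H)) =
      (V : H →L[ℂ] H) * truncationDefect P G K σ * star (V : H →L[ℂ] H) := by
  have h := Unitary.conjStarAlgAut_apply (S := ℂ) V
  have hP : Unitary.conjStarAlgAut ℂ (H →L[ℂ] H) V P = P := by
    rw [h, hV.eq, mul_assoc, Unitary.mul_star_self_of_mem V.2, mul_one]
  have e : P * ((V : H →L[ℂ] H) * G * star (V : H →L[ℂ] H)) =
      (V : H →L[ℂ] H) * (P * G) * star (V : H →L[ℂ] H) := by
    rw [← h, ← h, map_mul, hP]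
  have e2 : star ((V : H →L[ℂ] H) * (P * G) * star (V : H →L[ℂ] H)) *
      ((V : H →L[ℂ] H) * (P * G) * star (V : H →L[ℂ] H)) =
      (V : H →L[ℂ] H) * (star (P * G) * (P * G)) * star (V : H →L[ℂ] H) := by
    rw [star_conj, ← h, ← h, ← h, ← map_mul]
  rw [truncationDefect, truncationDefect, e, e2, boundedDissipator_conj, boundedDissipator_conj,
    mul_sub, sub_mul]

/-- Pure algebra once `G = W - P` and `K = D - W - T + P`. The jump part contributes `-(1 - P) W σ`
and the anticommutator `+½ (1 - P) W σ`, each with its adjoint, which leaves the coefficient `-½`.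
-/
theorem truncationDefect_eq {P W D T σ : H →L[ℂ] H} (hP : star P = P) (hPP : P * P = P)
    (hσ : star σ = σ) (hl : P * σ = σ) (hr : σ * P = σ) (hT : P * T = star W * P) :
    truncationDefect P (W - P) (D - W - T + P) σ =
      (W * σ * star W - P * (W * σ * star W) * P) -
        (1 / 2 : ℂ) • ((1 - P) * W * σ + star ((1 - P) * W * σ)) -
        (1 / 2 : ℂ) • ((D - star W * P * W) * σ + star ((D - star W * P * W) * σ)) +
        (1 / 2 : ℂ) • ((1 - P) * T * σ + star ((1 - P) * T * σ)) := by
  have e1 : star (P * (W - P)) = star W * P - P := by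
    rw [mul_sub, hPP, star_sub, star_mul, hP]
  have hK : star (P * (W - P)) * (P * (W - P)) =
      star W * P * W - star W * P - P * W + P := by
    rw [e1, mul_sub, hPP, sub_mul, mul_sub, mul_sub, mul_assoc _ P P, hPP, ← mul_assoc P P W, hPP,
      ← mul_assoc (star W * P) P W, mul_assoc (star W) P P, hPP]
    abel
  have hKs : star (star (P * (W - P)) * (P * (W - P))) =
      star (P * (W - P)) * (P * (W - P)) := by rw [star_mul, star_star]
  -- By `hT` the term `W† P` equals `P T`, which pairs with `-T`, as `P W` pairs with `-W`.
  have hZ : D - W - T + P - star (P * (W - P)) * (P * (W - P)) =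
      (D - star W * P * W) - (1 - P) * W - (1 - P) * T := by
    rw [hK, ← hT, sub_mul, sub_mul, one_mul, one_mul]
    abel
  have h1 : (W - P) * σ * star (W - P) = W * σ * star W - W * σ - star (W * σ) + σ := by
    rw [star_sub, hP, sub_mul, hl, sub_mul, mul_sub, mul_sub, hr, mul_assoc W σ P, hr, star_mul, hσ]
    abel
  have h2 : P * (W - P) * σ * star (P * (W - P)) =
      P * (W * σ * star W) * P - P * W * σ - star (P * W * σ) + σ := by
    rw [e1, mul_sub P, hPP, sub_mul, hl, sub_mul, mul_sub, mul_sub, hr, mul_assoc (P * W) σ P, hr,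
      star_mul, star_mul, hσ, hP]
    noncomm_ring
  have h3 : truncationDefect P (W - P) (D - W - T + P) σ =
      ((W - P) * σ * star (W - P) - P * (W - P) * σ * star (P * (W - P))) -
      (1 / 2 : ℂ) • ((D - W - T + P - star (P * (W - P)) * (P * (W - P))) * σ +
        star ((D - W - T + P - star (P * (W - P)) * (P * (W - P))) * σ)) := by
    rw [truncationDefect, boundedDissipator, boundedDissipator, hKs]
    generalize star (P * (W - P)) * (P * (W - P)) = L at hKs
    rw [star_mul _ σ, star_sub _ L, hKs, hσ, sub_mul (D - W - T + P), mul_sub σ]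
    module
  rw [h3, h1, h2, hZ]
  simp only [sub_mul, one_mul, star_sub]
  module

theorem sub_conj_proj_eq {P B : H →L[ℂ] H} (hP : star P = P) (hB : star B = B) :
    B - P * B * P = (1 - P) * B * (1 - P) + ((1 - P) * B * P + star ((1 - P) * B * P)) := by
  rw [star_mul, star_mul, star_one_sub_eq hP, hB, hP]
  noncomm_ring

/-- The left side is `Y† (1 - V† P V) Y`. Since `Y` takes values in the range of `P₁`, the bracket
may be compressed by `P₁`, and `P P₁ = P` lets `V` be compressed too. -/
theorem star_mul_self_compl_mul {P P₁ V Y : H →L[ℂ] H} (hP : star P = P) (hPP : P * P = P)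
    (hP₁ : star P₁ = P₁) (hPP₁ : P * P₁ = P) (hV : star V * V = 1) (hY : P₁ * Y = Y) :
    star ((1 - P) * V * Y) * ((1 - P) * V * Y) =
      star Y * (P₁ - star (P₁ * V * P₁) * P * (P₁ * V * P₁)) * Y := by
  have hY' : star Y * P₁ = star Y := by rw [← hP₁, ← star_mul, hY]
  have hPP₁' : P₁ * P = P := by
    have h := congrArg star hPP₁
    rwa [star_mul, hP, hP₁] at h
  have h1 : star (P₁ * V * P₁) * P * (P₁ * V * P₁) = P₁ * (star V * P * V) * P₁ := by
    rw [star_mul, star_mul, hP₁]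
    calc P₁ * (star V * P₁) * P * (P₁ * V * P₁)
        = P₁ * (star V * ((P₁ * P) * P₁) * V) * P₁ := by noncomm_ring
      _ = P₁ * (star V * P * V) * P₁ := by rw [hPP₁', hPP₁]
  have h2 : star V * ((1 - P) * ((1 - P) * V)) = 1 - star V * P * V := by
    have h3 : (1 - P) * ((1 - P) * V) = V - P * V := by
      have h5 : (1 - P) * ((1 - P) * V) = V - P * V - P * V + P * P * V := by noncomm_ring
      rw [h5, hPP]
      abel
    rw [h3, mul_sub, hV, mul_assoc]
  have h4 : star Y * (P₁ * (star V * P * V) * P₁) * Y =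
      (star Y * P₁) * (star V * P * V) * (P₁ * Y) := by noncomm_ring
  rw [h1, mul_sub (star Y), sub_mul (star Y * P₁), h4, hY', hY, star_mul, star_mul, star_sub,
    star_one, hP]
  calc star Y * (star V * (1 - P)) * ((1 - P) * V * Y)
      = star Y * (star V * ((1 - P) * ((1 - P) * V))) * Y := by noncomm_ring
    _ = star Y * Y - star Y * (star V * P * V) * Y := by
      rw [h2, mul_sub, sub_mul, mul_one]

theorem conj_nonneg {B : H →L[ℂ] H} (hB : 0 ≤ B) (A : H →L[ℂ] H) : 0 ≤ A * B * star A :=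
  star_right_conjugate_nonneg hB A

theorem norm_unitary_le_one (V : unitary (H →L[ℂ] H)) : ‖(V : H →L[ℂ] H)‖ ≤ 1 := by
  refine ContinuousLinearMap.opNorm_le_bound _ zero_le_one fun x => ?_
  rw [one_mul]
  exact (Unitary.norm_map V x).le

end Algebra

/-! ### Trace-norm estimates for self-adjoint parts and blocks. -/

theorem traceNorm_half_smul_add_star_le (X : Fock →L[ℂ] Fock) :
    traceNorm ((1 / 2 : ℂ) • (X + star X)) ≤ traceNorm X := by
  refine (traceNorm_smul_le _ _).trans ?_
  have h : ‖(1 / 2 : ℂ)‖ₑ * (2 * traceNorm X) = traceNorm X := by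
    have h2 : ‖(1 / 2 : ℂ)‖ₑ * 2 = 1 := by
      have h3 : ‖(2 : ℂ)‖ₑ = 2 := by
        rw [← ofReal_norm, Complex.norm_ofNat, ENNReal.ofReal_ofNat]
      rw [← h3, ← enorm_mul]
      norm_num
    rw [← mul_assoc, h2, one_mul]
  refine le_trans ?_ h.le
  gcongr
  rw [two_mul]
  refine (traceNorm_add_le _ _).trans ?_
  rw [traceNorm_star]

theorem traceNorm_neg_le (X : Fock →L[ℂ] Fock) : traceNorm (-X) ≤ traceNorm X := by
  simpa using traceNorm_smul_le (-1) X

theorem traceNorm_sub_le (X Y : Fock →L[ℂ] Fock) :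
    traceNorm (X - Y) ≤ traceNorm X + traceNorm Y := by
  rw [sub_eq_add_neg]
  exact (traceNorm_add_le _ _).trans (add_le_add_right (traceNorm_neg_le Y) _)

/-- For positive operators the trace norm is the trace, and each basis vector `|n⟩` contributes to
exactly one of the two diagonal blocks. -/
theorem traceNorm_eq_proj_add_proj {B : Fock →L[ℂ] Fock} (hB : 0 ≤ B) (N : ℕ) :
    traceNorm B = traceNorm (proj N * B * proj N) +
      traceNorm ((1 - proj N) * B * (1 - proj N)) := by
  have h1 : 0 ≤ proj N * B * proj N := by
    have := conj_nonneg hB (proj N)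
    rwa [star_proj] at this
  have h2 : 0 ≤ (1 - proj N) * B * (1 - proj N) := by
    have := conj_nonneg hB (1 - proj N)
    rwa [star_one_sub_eq (star_proj N)] at this
  rw [traceNorm_of_nonneg hB, traceNorm_of_nonneg h1, traceNorm_of_nonneg h2, ← ENNReal.tsum_add]
  refine tsum_congr fun n => ?_
  have e1 : inner ℂ (ket n) ((proj N * B * proj N) (ket n)) =
      inner ℂ (proj N (ket n)) (B (proj N (ket n))) := (inner_proj_left N _ _).symm
  have e2 : inner ℂ (ket n) (((1 - proj N) * B * (1 - proj N)) (ket n)) =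
      inner ℂ (ket n - proj N (ket n)) (B (ket n - proj N (ket n))) := by
    change inner ℂ (ket n) (B (ket n - proj N (ket n)) - proj N (B (ket n - proj N (ket n)))) = _
    rw [inner_sub_right, inner_sub_left, inner_proj_left]
  rw [e1, e2, proj_ket]
  split_ifs <;> simp

/-- Trace-norm bound for the truncation defect. -/
theorem traceNorm_truncationDefect_le {N : ℕ} {W D T σ : Fock →L[ℂ] Fock} (hσ : 0 ≤ σ)
    (hl : proj N * σ = σ) (hr : σ * proj N = σ) (hT : proj N * T = star W * proj N) :
    traceNorm (truncationDefect (proj N) (W - proj N) (D - W - T + proj N) σ) ≤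
      traceNorm ((1 - proj N) * (W * σ * star W) * (1 - proj N)) +
        2 * traceNorm ((1 - proj N) * (W * σ * star W) * proj N) +
        traceNorm ((1 - proj N) * W * σ) + traceNorm ((D - star W * proj N * W) * σ) +
        traceNorm ((1 - proj N) * T * σ) := by
  rw [truncationDefect_eq (star_proj N) (proj_mul_self N) (star_eq_of_nonneg hσ) hl hr hT,
    sub_conj_proj_eq (star_proj N) (star_eq_of_nonneg (conj_nonneg hσ W))]
  refine (traceNorm_add_le _ _).trans (add_le_add ?_ (traceNorm_half_smul_add_star_le _))
  refine (traceNorm_sub_le _ _).trans (add_le_add ?_ (traceNorm_half_smul_add_star_le _))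
  refine (traceNorm_sub_le _ _).trans (add_le_add ?_ (traceNorm_half_smul_add_star_le _))
  refine (traceNorm_add_le _ _).trans (add_le_add le_rfl ?_)
  refine (traceNorm_add_le _ _).trans ?_
  rw [traceNorm_star, two_mul]

/-! ### The estimator -/

section Estimator

variable (𝒜 η ε : ℝ) (N : ℕ)

theorem proj_mul_expPosition_mul_onTrunc :
    proj N * ((expPosition η : Fock →L[ℂ] Fock) * onTrunc (polyQ 𝒜 ε) N) =
      proj N * (expTrunc η N * onTrunc (polyQ 𝒜 ε) N) := by
  rw [expTrunc, mul_assoc _ (proj (N + 1)), proj_succ_mul_onTrunc_polyQ, mul_assoc (proj (N + 1)),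
    ← mul_assoc (proj N) (proj (N + 1)), proj_mul_proj_of_ge N.le_succ]

/-- `P_N U† (𝒜 S) P_N = P_N Q U† P_N`. -/
theorem proj_mul_smul_star_expPosition :
    proj N * ((𝒜 : ℂ) • (star (expPosition η : Fock →L[ℂ] Fock) * onTrunc (polyS η ε) N)) =
      star ((expPosition η : Fock →L[ℂ] Fock) * onTrunc (polyQ 𝒜 ε) N) * proj N := by
  refine ContinuousLinearMap.ext fun u => ext_inner_right ℂ fun v => ?_
  change inner ℂ (proj N ((𝒜 : ℂ) • (star (expPosition η : Fock →L[ℂ] Fock)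
      (onTrunc (polyS η ε) N u)))) v =
    inner ℂ (star ((expPosition η : Fock →L[ℂ] Fock) * onTrunc (polyQ 𝒜 ε) N) (proj N u)) v
  rw [inner_proj_left, inner_smul_left, Complex.conj_ofReal, inner_star_left, inner_star_left,
    onTrunc_apply]
  have h := inner_polyS_expPosition 𝒜 η ε (projF N u) (projF N v)
  refine h.trans ?_
  rw [← onTrunc_apply]
  rfl

theorem star_onTrunc_mul_star_expPosition_mul_proj :
    star (onTrunc (polyQ 𝒜 ε) N) * star (expPosition η : Fock →L[ℂ] Fock) * proj N =
      star (onTrunc (polyQ 𝒜 ε) N) * star (expTrunc η N) * proj N := by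
  have h := congrArg (fun A : Fock →L[ℂ] Fock => star A)
    (proj_mul_expPosition_mul_onTrunc 𝒜 η ε N)
  simp only [star_mul_eq, star_proj] at h
  exact h

/-- Finite rank of `P_N` makes every term trace class, so no `toReal` below collapses an infinite
norm to `0`. -/
theorem traceNorm_mul_ne_top_of_proj_mul {σ : Fock →L[ℂ] Fock} (hl : proj N * σ = σ)
    (A B : Fock →L[ℂ] Fock) : traceNorm (A * σ * B) ≠ ⊤ := by
  have h := traceNorm_mul_ne_top A (σ * B) (traceNorm_proj_ne_top N)
  rwa [mul_assoc A, ← mul_assoc (proj N), hl, ← mul_assoc] at h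

theorem traceNorm_jump_defect_le_estimator {σ : Fock →L[ℂ] Fock} (hσ : 0 ≤ σ)
    (hl : proj N * σ = σ) (hr : σ * proj N = σ) :
    traceNorm (truncationDefect (proj N) (jumpTrunc 𝒜 η ε N) (jumpSqTrunc 𝒜 η ε N) σ) ≠ ⊤ ∧
    (traceNorm (truncationDefect (proj N) (jumpTrunc 𝒜 η ε N)
      (jumpSqTrunc 𝒜 η ε N) σ)).toReal ≤ estimator 𝒜 η ε N σ := by
  set P := proj N with hP
  set U := (expPosition η : Fock →L[ℂ] Fock) with hU
  set U₁ := expTrunc η N with hU₁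
  set Q := onTrunc (polyQ 𝒜 ε) N with hQ
  set D := onTrunc (polyQ 𝒜 ε * polyQ 𝒜 ε) N with hD
  set S := onTrunc (polyS η ε) N with hS
  have hfin := traceNorm_mul_ne_top_of_proj_mul N hl
  have hest : estimator 𝒜 η ε N σ =
      (trace (Q * σ * star Q)).re - (trace (P * U * Q * σ * star Q * star U * P)).re
      + 2 * (traceNorm ((1 - P) * U * Q * σ * star Q * star U * P)).toReal
      + (traceNorm ((D - star Q * star U₁ * P * U₁ * Q) * σ)).toReal
      + (traceNorm ((1 - P) * U * Q * σ)).toReal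
      + |𝒜| * (traceNorm ((1 - P) * star U * S * σ)).toReal := rfl
  have hmain := traceNorm_truncationDefect_le (W := U * Q) (D := D) (T := (𝒜 : ℂ) • (star U * S))
    hσ hl hr (proj_mul_smul_star_expPosition 𝒜 η ε N)
  have hB : 0 ≤ U * Q * σ * star (U * Q) := conj_nonneg hσ _
  have hBU : U * Q * σ * star (U * Q) = U * (Q * σ * star Q) * star U := by
    rw [star_mul_eq]
    noncomm_ring
  have e1 : P * U * Q * σ * star Q * star U * P = P * (U * Q * σ * star (U * Q)) * P := by
    rw [star_mul_eq]
    noncomm_ring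
  have e2 : (1 - P) * U * Q * σ * star Q * star U * P =
      (1 - P) * (U * Q * σ * star (U * Q)) * P := by
    rw [star_mul_eq]
    simp only [mul_assoc]
  have e3 : D - star Q * star U₁ * P * U₁ * Q = D - star (U * Q) * P * (U * Q) := by
    have h : star Q * star U * P * (U * Q) = star Q * star U₁ * P * (U₁ * Q) := by
      rw [← star_onTrunc_mul_star_expPosition_mul_proj, mul_assoc _ P, mul_assoc _ P,
        proj_mul_expPosition_mul_onTrunc]
    rw [star_mul_eq, h, ← mul_assoc]
  have e5 : (1 - P) * ((𝒜 : ℂ) • (star U * S)) * σ = (𝒜 : ℂ) • ((1 - P) * star U * S * σ) := by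
    rw [mul_smul_comm, smul_mul_assoc]
    simp only [mul_assoc]
  have hP0 : 0 ≤ P * (U * Q * σ * star (U * Q)) * P := by
    have h := conj_nonneg hB P
    rwa [star_proj] at h
  have f0 := hfin Q (star Q)
  have fB : traceNorm (U * Q * σ * star (U * Q)) ≠ ⊤ := hfin _ _
  have hsplit := traceNorm_eq_proj_add_proj hB N
  have fB1 : traceNorm (P * (U * Q * σ * star (U * Q)) * P) ≠ ⊤ :=
    ne_top_of_le_ne_top fB (hsplit.ge.trans' le_self_add)
  have fB2 : traceNorm ((1 - P) * (U * Q * σ * star (U * Q)) * (1 - P)) ≠ ⊤ :=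
    ne_top_of_le_ne_top fB (hsplit.ge.trans' le_add_self)
  have f2 : traceNorm ((1 - P) * (U * Q * σ * star (U * Q)) * P) ≠ ⊤ :=
    traceNorm_mul_ne_top _ _ fB
  have f3 : traceNorm ((D - star (U * Q) * P * (U * Q)) * σ) ≠ ⊤ := by
    simpa using hfin (D - star (U * Q) * P * (U * Q)) 1
  have f4 : traceNorm ((1 - P) * U * Q * σ) ≠ ⊤ := by simpa using hfin ((1 - P) * U * Q) 1
  have f5 : traceNorm ((1 - P) * star U * S * σ) ≠ ⊤ := by
    simpa using hfin ((1 - P) * star U * S) 1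
  have hBle : traceNorm (U * Q * σ * star (U * Q)) ≤ traceNorm (Q * σ * star Q) := by
    rw [hBU]
    exact traceNorm_mul_mul_le _ (norm_unitary_le_one (expPosition η))
      ((norm_star_eq U).trans_le (norm_unitary_le_one (expPosition η)))
  -- The corner equals `Tr B - Tr P B P`, and `Tr B ≤ Tr Q σ Q†` because `U` and `U†` are
  -- contractions.
  have hterm : (traceNorm ((1 - P) * (U * Q * σ * star (U * Q)) * (1 - P))).toReal ≤
      (trace (Q * σ * star Q)).re - (trace (P * U * Q * σ * star Q * star U * P)).re := by
    rw [e1, re_trace_of_nonneg (conj_nonneg hσ Q) f0, re_trace_of_nonneg hP0 fB1,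
      le_sub_iff_add_le', ← ENNReal.toReal_add fB1 fB2]
    exact ENNReal.toReal_mono f0 (hsplit.ge.trans hBle)
  rw [← hP, e5, ← mul_assoc (1 - P) U Q] at hmain
  have hle := hmain.trans (add_le_add_right (traceNorm_smul_le (𝒜 : ℂ) _) _)
  have g2 : 2 * traceNorm ((1 - P) * (U * Q * σ * star (U * Q)) * P) ≠ ⊤ :=
    ENNReal.mul_ne_top (by simp) f2
  have g5 : ‖(𝒜 : ℂ)‖ₑ * traceNorm ((1 - P) * star U * S * σ) ≠ ⊤ :=
    ENNReal.mul_ne_top enorm_ne_top f5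
  have s1 := ENNReal.add_ne_top.2 ⟨fB2, g2⟩
  have s2 := ENNReal.add_ne_top.2 ⟨s1, f4⟩
  have s3 := ENNReal.add_ne_top.2 ⟨s2, f3⟩
  have s4 := ENNReal.add_ne_top.2 ⟨s3, g5⟩
  refine ⟨ne_top_of_le_ne_top s4 hle, (ENNReal.toReal_mono s4 hle).trans ?_⟩
  rw [ENNReal.toReal_add s3 g5, ENNReal.toReal_add s2 f3, ENNReal.toReal_add s1 f4,
    ENNReal.toReal_add fB2 g2, ENNReal.toReal_mul, ENNReal.toReal_mul, toReal_enorm,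
    Complex.norm_real, Real.norm_eq_abs, ENNReal.toReal_ofNat, hest, e2, e3]
  linarith

theorem estimator_eq_estimatorTrunc (ρ : Fock →L[ℂ] Fock) :
    estimator 𝒜 η ε N ρ = estimatorTrunc 𝒜 η ε N ρ := by
  set P := proj N with hP
  set P₁ := proj (N + 1) with hP₁
  set U := (expPosition η : Fock →L[ℂ] Fock) with hU
  set U₁ := expTrunc η N with hU₁
  set Q := onTrunc (polyQ 𝒜 ε) N with hQ
  set D := onTrunc (polyQ 𝒜 ε * polyQ 𝒜 ε) N with hD
  set S := onTrunc (polyS η ε) N with hS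
  have hest : estimator 𝒜 η ε N ρ =
      (trace (Q * ρ * star Q)).re - (trace (P * U * Q * ρ * star Q * star U * P)).re
      + 2 * (traceNorm ((1 - P) * U * Q * ρ * star Q * star U * P)).toReal
      + (traceNorm ((D - star Q * star U₁ * P * U₁ * Q) * ρ)).toReal
      + (traceNorm ((1 - P) * U * Q * ρ)).toReal
      + |𝒜| * (traceNorm ((1 - P) * star U * S * ρ)).toReal := rfl
  have hestT : estimatorTrunc 𝒜 η ε N ρ =
      (trace (Q * ρ * star Q)).re - (trace (P * U₁ * Q * ρ * star Q * star U₁ * P)).re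
      + 2 * (traceSqrt (star (Q * ρ * star Q * star U₁ * P) * (P₁ - star U₁ * P * U₁) *
          (Q * ρ * star Q * star U₁ * P))).toReal
      + (traceNorm ((D - star Q * star U₁ * P * U₁ * Q) * ρ)).toReal
      + (traceSqrt (star (Q * ρ) * (P₁ - star U₁ * P * U₁) * (Q * ρ))).toReal
      + |𝒜| * (traceSqrt (star (S * ρ) * (P₁ - U₁ * P * star U₁) * (S * ρ))).toReal := rfl
  have hstar := star_onTrunc_mul_star_expPosition_mul_proj 𝒜 η ε N
  have hpq := proj_mul_expPosition_mul_onTrunc 𝒜 η ε N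
  have hPP₁ : P * P₁ = P := proj_mul_proj_of_ge N.le_succ
  have hQ₁ : P₁ * Q = Q := proj_succ_mul_onTrunc_polyQ 𝒜 ε N
  have hS₁ : P₁ * S = S := proj_succ_mul_onTrunc_polyS η ε N
  have hUU : star U * U = 1 := Unitary.star_mul_self_of_mem (expPosition η).2
  have hUU' : star (star U) * star U = 1 := by
    rw [star_star]
    exact Unitary.mul_star_self_of_mem (expPosition η).2
  have hsU₁ : P₁ * star U * P₁ = star U₁ := by
    have h : star U₁ = star (P₁ * U * P₁) := rfl
    rw [h, star_mul_eq, star_mul_eq, star_proj, mul_assoc]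
  have c : ∀ Y : Fock →L[ℂ] Fock, P₁ * Y = Y →
      traceNorm ((1 - P) * U * Y) = traceSqrt (star Y * (P₁ - star U₁ * P * U₁) * Y) :=
    fun Y hY => congrArg traceSqrt (star_mul_self_compl_mul (star_proj N) (proj_mul_self N)
      (star_proj (N + 1)) hPP₁ hUU hY)
  -- The same identity with `V = U†`, which needs the other half of unitarity; the compression of
  -- `U†` is the adjoint of `U_{N+1}`.
  have c' : ∀ Y : Fock →L[ℂ] Fock, P₁ * Y = Y →
      traceNorm ((1 - P) * star U * Y) = traceSqrt (star Y * (P₁ - U₁ * P * star U₁) * Y) := by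
    intro Y hY
    have h := star_mul_self_compl_mul (star_proj N) (proj_mul_self N)
      (star_proj (N + 1)) hPP₁ hUU' hY
    have hss : star (star U₁) = U₁ := star_star U₁
    rw [hsU₁, hss] at h
    exact congrArg traceSqrt h
  have e1 : P * U * Q * ρ * star Q * star U * P = P * U₁ * Q * ρ * star Q * star U₁ * P := by
    calc P * U * Q * ρ * star Q * star U * P = P * (U * Q) * ρ * (star Q * star U * P) := by
          simp only [mul_assoc]
      _ = P * (U₁ * Q) * ρ * (star Q * star U₁ * P) := by rw [hstar, hpq]
      _ = _ := by simp only [mul_assoc]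
  have e2 : (1 - P) * U * Q * ρ * star Q * star U * P =
      (1 - P) * U * (Q * ρ * star Q * star U₁ * P) := by
    calc (1 - P) * U * Q * ρ * star Q * star U * P
        = (1 - P) * U * (Q * ρ * (star Q * star U * P)) := by simp only [mul_assoc]
      _ = (1 - P) * U * (Q * ρ * (star Q * star U₁ * P)) := by rw [hstar]
      _ = _ := by simp only [mul_assoc]
  rw [hest, hestT, e1, e2, c _ (by simp only [← mul_assoc, hQ₁]), mul_assoc ((1 - P) * U) Q,
    c _ (by rw [← mul_assoc, hQ₁]), mul_assoc ((1 - P) * star U) S,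
    c' _ (by rw [← mul_assoc, hS₁])]

end Estimator

end GKP

end

theorem mainTheorem9 (𝒜 η ε : ℝ) (N : ℕ) (ρ : GKP.Fock →L[ℂ] GKP.Fock)
    (hpos : ρ.IsPositive) (hsupp : GKP.proj N * ρ * GKP.proj N = ρ) :
    (∃ X : GKP.Fock →L[ℂ] GKP.Fock,
      GKP.IsBoundedExtension
        (GKP.lindbladian 𝒜 η ε ρ - GKP.lindbladianTrunc 𝒜 η ε N ρ) X ∧
      GKP.traceNorm X ≠ ⊤ ∧
      (GKP.traceNorm X).toReal ≤
        ∑ k ∈ Finset.range 4, GKP.estimator 𝒜 η ε N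
          (((GKP.rotation⁻¹ ^ k : unitary (GKP.Fock →L[ℂ] GKP.Fock)) : GKP.Fock →L[ℂ] GKP.Fock)
            * ρ *
            ((GKP.rotation ^ k : unitary (GKP.Fock →L[ℂ] GKP.Fock)) :
              GKP.Fock →L[ℂ] GKP.Fock))) ∧
    GKP.estimator 𝒜 η ε N ρ = GKP.estimatorTrunc 𝒜 η ε N ρ := by
  have hl : GKP.proj N * ρ = ρ := by
    rw [← hsupp, ← mul_assoc, ← mul_assoc, GKP.proj_mul_self]
  have hr : ρ * GKP.proj N = ρ := by
    rw [← hsupp, mul_assoc, GKP.proj_mul_self]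
  have hρ : 0 ≤ ρ := (ContinuousLinearMap.nonneg_iff_isPositive ρ).2 hpos
  refine ⟨⟨_, GKP.isBoundedExtension_lindbladian_sub 𝒜 η ε hl hr, ?_⟩,
    GKP.estimator_eq_estimatorTrunc 𝒜 η ε N ρ⟩
  -- The defect at `ρ` for `Γ_k` is the `R^k`-conjugate of the defect at `σ = R^{-k} ρ R^k` for
  -- `Γ₀`. Conjugation does not increase the trace norm, and `σ` is again positive and supported on
  -- `H_N`.
  have key : ∀ k, GKP.traceNorm (GKP.truncationDefect (GKP.proj N)
        (GKP.conjRotation k (GKP.jumpTrunc 𝒜 η ε N))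
        (GKP.conjRotation k (GKP.jumpSqTrunc 𝒜 η ε N)) ρ) ≠ ⊤ ∧
      (GKP.traceNorm (GKP.truncationDefect (GKP.proj N)
        (GKP.conjRotation k (GKP.jumpTrunc 𝒜 η ε N))
        (GKP.conjRotation k (GKP.jumpSqTrunc 𝒜 η ε N)) ρ)).toReal ≤
      GKP.estimator 𝒜 η ε N
        (((GKP.rotation⁻¹ ^ k : unitary (GKP.Fock →L[ℂ] GKP.Fock)) : GKP.Fock →L[ℂ] GKP.Fock)
          * ρ *
          ((GKP.rotation ^ k : unitary (GKP.Fock →L[ℂ] GKP.Fock)) :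
            GKP.Fock →L[ℂ] GKP.Fock)) := by
    intro k
    rw [GKP.coe_rotation_inv_pow]
    have hc := GKP.commute_rotation_pow_proj k N
    have hcs := GKP.star_commute_proj hc
    unfold GKP.conjRotation
    set V : unitary (GKP.Fock →L[ℂ] GKP.Fock) := GKP.rotation ^ k
    have hVV : (V : GKP.Fock →L[ℂ] GKP.Fock) * star (V : GKP.Fock →L[ℂ] GKP.Fock) = 1 :=
      Unitary.mul_star_self_of_mem V.2
    set σ := star (V : GKP.Fock →L[ℂ] GKP.Fock) * ρ * (V : GKP.Fock →L[ℂ] GKP.Fock) with hσ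
    have hρσ : ρ = (V : GKP.Fock →L[ℂ] GKP.Fock) * σ * star (V : GKP.Fock →L[ℂ] GKP.Fock) := by
      calc ρ = 1 * ρ * 1 := by rw [one_mul, mul_one]
        _ = _ := by rw [← hVV, hσ]; simp only [mul_assoc]
    have hσ0 : 0 ≤ σ := by
      have h := GKP.conj_nonneg hρ (star (V : GKP.Fock →L[ℂ] GKP.Fock))
      have hss : star (star (V : GKP.Fock →L[ℂ] GKP.Fock)) = (V : GKP.Fock →L[ℂ] GKP.Fock) :=
        star_star _
      rwa [hss] at h
    have hσl : GKP.proj N * σ = σ := by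
      rw [hσ, ← mul_assoc, ← mul_assoc, ← hcs.eq, mul_assoc _ (GKP.proj N), hl]
    have hσr : σ * GKP.proj N = σ := by
      rw [hσ, mul_assoc, hc.eq, ← mul_assoc, mul_assoc _ ρ, hr]
    have h := GKP.traceNorm_jump_defect_le_estimator 𝒜 η ε N hσ0 hσl hσr
    have hle : GKP.traceNorm (GKP.truncationDefect (GKP.proj N)
        ((V : GKP.Fock →L[ℂ] GKP.Fock) * GKP.jumpTrunc 𝒜 η ε N *
          star (V : GKP.Fock →L[ℂ] GKP.Fock))
        ((V : GKP.Fock →L[ℂ] GKP.Fock) * GKP.jumpSqTrunc 𝒜 η ε N *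
          star (V : GKP.Fock →L[ℂ] GKP.Fock)) ρ) ≤
        GKP.traceNorm (GKP.truncationDefect (GKP.proj N) (GKP.jumpTrunc 𝒜 η ε N)
          (GKP.jumpSqTrunc 𝒜 η ε N) σ) := by
      have e := GKP.truncationDefect_conj V hc (GKP.jumpTrunc 𝒜 η ε N)
        (GKP.jumpSqTrunc 𝒜 η ε N) σ
      rw [← hρσ] at e
      rw [e]
      exact GKP.traceNorm_mul_mul_le _ (GKP.norm_unitary_le_one V)
        ((GKP.norm_star_eq _).trans_le (GKP.norm_unitary_le_one V))
    exact ⟨ne_top_of_le_ne_top h.1 hle, (ENNReal.toReal_mono h.1 hle).trans h.2⟩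
  have hle := GKP.traceNorm_sum_le (Finset.range 4) fun k => GKP.truncationDefect (GKP.proj N)
    (GKP.conjRotation k (GKP.jumpTrunc 𝒜 η ε N)) (GKP.conjRotation k (GKP.jumpSqTrunc 𝒜 η ε N)) ρ
  have hfin := ENNReal.sum_ne_top.2 fun k (_ : k ∈ Finset.range 4) => (key k).1
  refine ⟨ne_top_of_le_ne_top hfin hle, (ENNReal.toReal_mono hfin hle).trans ?_⟩
  rw [ENNReal.toReal_sum fun k _ => (key k).1]
  exact Finset.sum_le_sum fun k _ => (key k).2
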